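/- A \emph{collaborative learning problem} $(\mathcal H,\mathcal D)$ consists of a feature space $\mathcal X$, a label space $\mathcal Y$, a loss $\ell:\mathcal Y^{\mathcal X}\times(\mathcal X\times\mathcal Y)\to[0,1]$, a finite non-empty class $\mathcal H\subset\mathcal Y^{\mathcal X}$ and a finite non-empty set $\mathcal D=\{D_1,\dots,D_{|\mathcal D|}\}$ of probability distributions on $\mathcal X\times\mathcal Y$. For $f\in\mathcal Y^{\mathcal X}$ put $\mathcal R_D(f)=\mathbb E_{z\sim D}[\ell(f,z)]$, and for a randomized predictor $h$, i.e. a (discrete) probability distribution on $\mathcal Y^{\mathcal X}$, put $\mathcal R_D(h)=\mathbb E_{f\sim h}[\mathcal R_D(f)]$. A (possibly randomized, possibly improper) predictor $h$ is \emph{$\epsilon$-optimal} if $$\max_{D\in\mathcal D}\mathcal R_D(h)\le \mathrm{OPT}+\epsilon,\qquad \mathrm{OPT}=\min_{f\in\mathcal H}\max_{D\in\mathcal D}\mathcal R_D(f).$$ A learning algorithm $\mathcal Q$ knows $\mathcal X,\mathcal Y,\ell,\mathcal H$ and $|\mathcal D|$, but accesses $\mathcal D$ only through example oracles $\mathrm{EX}(D_1),\dots,\mathrm{EX}(D_{|\mathcal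 D|})$, where $\mathrm{EX}(D_i)$ returns independent samples from $D_i$. It may use internal randomness, chooses adaptively which oracle to call next and when to stop, and on stopping returns a predictor. Its \emph{sample complexity} $N_{\mathcal Q}(\mathcal H,\mathcal D)\in[0,\infty]$ on a problem is the expected total number of oracle calls, over the samples and the internal randomness. $\mathcal Q$ is an \emph{$(\epsilon,\delta)$-collaborative learning algorithm} if on every collaborative learning problem it returns an $\epsilon$-optimal predictor with probability at least $1-\delta$. \textbf{Theorem.} There is a universal constant $c>0$ such that the following holds. For all integers $n,d\ge 1$, all $\epsilon,\delta\in(0,1/8)$ and every $(\epsilon,\delta)$-collaborative learning algorithm $\mathcal Q$, there is a collaborative learning problem $(\mathcal H,\mathcal D)$ with $|\mathcal D|=n$ and $|\mathcal H|=2^d$ such that $$N_{\mathcal Q}(\mathcal H,\mathcal D)\ \ge\ \frac{c}{\epsilon^{2}}\Bigl(d+n\log\frac{\min\{n,d\}}{\delta}\Bigr).$$ In particular, when $n\le d$, $$N_{\mathcal Q}(\mathcal H,\mathcal D)\ \ge\ \frac{c}{\epsilon^{2}}\Bigl(d+n\log\frac{n}{\delta}\Bigr).$$ -/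

import Mathlib

open MeasureTheory
open scoped ENNReal

noncomputable section

namespace CollabLearning

/-- A deterministic predictor: a measurable element of `Y^X`. -/
abbrev Predictor (X Y : Type) [MeasurableSpace X] [MeasurableSpace Y] : Type :=
  {f : X → Y // Measurable f}

/-- What the learner knows in advance about a collaborative learning problem: the feature space,
the label space, the number of data distributions, the `[0, 1]`-valued loss `ℓ(h, (x, y))` and the
finite hypothesis class. -/
structure Task where
  X : Type
  Y : Type
  [measX : MeasurableSpace X]
  [measY : MeasurableSpace Y]
  /-- number of data distributions -/
  n : ℕ
  n_pos : 0 < n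
  loss : Predictor X Y → X × Y → ℝ
  loss_mem : ∀ f z, loss f z ∈ Set.Icc (0 : ℝ) 1
  loss_meas : ∀ f, Measurable (loss f)
  /-- hypothesis class -/
  H : Finset (Predictor X Y)
  H_nonempty : H.Nonempty

attribute [instance] Task.measX Task.measY

namespace Task

/-- The space of data points. -/
abbrev Z (T : Task) : Type := T.X × T.Y

/-- Expected loss of a deterministic predictor on the distribution `D`. -/
def risk (T : Task) (D : Measure T.Z) (f : Predictor T.X T.Y) : ℝ :=
  ∫ z, T.loss f z ∂D

/-- Expected loss of a randomized (possibly improper) predictor `p`: the mean of the expected loss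
of `f` for `f` drawn from `p`. A deterministic predictor `f` corresponds to `PMF.pure f`, a
randomized proper solution to a `p` supported on `H`. -/
def randRisk (T : Task) (D : Measure T.Z) (p : PMF (Predictor T.X T.Y)) : ℝ :=
  ∑' f, (p f).toReal * T.risk D f

end Task

/-- The unknown part of a problem: a set `{D_1, ..., D_n}` of `n` data distributions. Together, `T`
and `D : DataDistributions T` form a collaborative learning problem. -/
structure DataDistributions (T : Task) where
  dist : Fin T.n → Measure T.Z
  isProb : ∀ i, IsProbabilityMeasure (dist i)
  injective : Function.Injective dist

attribute [instance] DataDistributions.isProb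

namespace DataDistributions

variable {T : Task}

/-- `OPT`: the smallest worst-case risk that a hypothesis of the class attains. -/
def opt (D : DataDistributions T) : ℝ :=
  T.H.inf' T.H_nonempty fun h => ⨆ i, T.risk (D.dist i) h

/-- `p` is an `ε`-optimal solution: its worst-case risk is at most `OPT + ε`. -/
def IsOptimal (D : DataDistributions T) (ε : ℝ) (p : PMF (Predictor T.X T.Y)) : Prop :=
  (⨆ i, T.randRisk (D.dist i) p) ≤ D.opt + ε

end DataDistributions

/-- An adaptive randomized learner for the task `T`. It draws an internal random seed; then, given
the list of the oracle calls made so far with the data points they returned (oldest first), it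
either calls the example oracle of some distribution `i` (`query = some i`) or stops
(`query = none`) and returns `output`. The last two fields say that the decisions, and the
risk of the output on any distribution, are random variables. -/
structure Learner (T : Task) where
  Seed : Type
  [measSeed : MeasurableSpace Seed]
  seedLaw : Measure Seed
  [seedProb : IsProbabilityMeasure seedLaw]
  query : Seed → List (Fin T.n × T.Z) → Option (Fin T.n)
  output : Seed → List (Fin T.n × T.Z) → PMF (Predictor T.X T.Y)
  query_meas : ∀ (t : ℕ) (o : Option (Fin T.n)),
    MeasurableSet {a : Seed × (Fin t → Fin T.n × T.Z) | query a.1 (List.ofFn a.2) = o}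
  output_meas : ∀ (t : ℕ) (D : Measure T.Z) [IsProbabilityMeasure D],
    Measurable fun a : Seed × (Fin t → Fin T.n × T.Z) =>
      T.randRisk D (output a.1 (List.ofFn a.2))

attribute [instance] Learner.measSeed Learner.seedProb

namespace Learner

variable {T : Task}

/-- The history after `t` steps. Here `ω t i` is the data point that the oracle of distribution `i`
returns if it is called at step `t`; only the one that is called for is revealed. After the learner
has stopped the history no longer changes. -/
def history (A : Learner T) (s : A.Seed) (ω : ℕ → Fin T.n → T.Z) : ℕ → List (Fin T.n × T.Z)
  | 0 => []
  | t + 1 =>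
    match A.query s (A.history s ω t) with
    | none => A.history s ω t
    | some i => A.history s ω t ++ [(i, ω t i)]

/-- The total number of oracle calls (`⊤` if the learner never stops). -/
def samples (A : Learner T) (s : A.Seed) (ω : ℕ → Fin T.n → T.Z) : ℝ≥0∞ :=
  ⨆ t, ((A.history s ω t).length : ℝ≥0∞)

/-- The joint law of the seed and of the oracle answers, when the data distributions are `D`: all
are independent, and each answer of the `i`-th oracle has law `D i`. -/
def law (A : Learner T) (D : DataDistributions T) :
    Measure (A.Seed × (ℕ → Fin T.n → T.Z)) :=
  A.seedLaw.prod (Measure.infinitePi fun _ : ℕ => Measure.pi D.dist)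

/-- The event that the learner stops and returns an `ε`-optimal solution. -/
def successEvent (A : Learner T) (D : DataDistributions T) (ε : ℝ) :
    Set (A.Seed × (ℕ → Fin T.n → T.Z)) :=
  {a | ∃ t, A.query a.1 (A.history a.1 a.2 t) = none ∧
    D.IsOptimal ε (A.output a.1 (A.history a.1 a.2 t))}

/-- Expected sample complexity on the problem `(T, D)`, over the data and the seed. -/
def expectedSamples (A : Learner T) (D : DataDistributions T) : ℝ≥0∞ :=
  ∫⁻ a, A.samples a.1 a.2 ∂(A.law D)

end Learner

/-- A collaborative learning algorithm is given the task (but not the data distributions). -/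
abbrev Algorithm : Type 1 := (T : Task) → Learner T

/-- `Q` is an `(ε, δ)`-collaborative learning algorithm: on every collaborative learning problem
(with a finite class) it returns an `ε`-optimal solution with probability at least `1 - δ`. -/
def IsCollaborativeLearner (Q : Algorithm) (ε δ : ℝ) : Prop :=
  ∀ (T : Task) (D : DataDistributions T),
    ENNReal.ofReal (1 - δ) ≤ (Q T).law D ((Q T).successEvent D ε)

end CollabLearning

end

/-! The two terms of the bound come from two families of problems; the larger term decides which
family is used. In both, a predictor is a code `v` in `{0,1}^d`, and a sample from oracle `i`
reveals one toss of every coin in a set `K`. The loss at oracle `i` is the toss of the coin `sel v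
i`. All coins are fair, except at most one per oracle, whose bias shifts its mean loss by `3ε`.

The term `d` (`exists_le_expectedSamples_identTask`): there is one coin per hypothesis, and at every
oracle the coin of a hidden `v` is favourable. An `ε`-optimal output has most of its mass on `v`, so
the success events for different `v` are disjoint and one of them has probability at most `2^(-d)`
under all-fair coins. Since a sample carries `O(ε^2)` of relative entropy, `d / ε^2` samples are
needed, as in Fano's inequality.

The term `n log(k/δ)`, `k = min n d` (`exists_le_expectedSamples_groupTask`): the oracles form `k`
groups of `m = n / k`, up to leftovers, and bit `j` of the code chooses one of two coins for group
`j`. A group is idle, or one of its oracles has one coin biased upwards and that side must be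
avoided. In an idle group the learner still favours some side; each oracle of the group could
secretly penalise that side, so each must be sampled about `log(1/error) / ε^2` times
(`group_cost`). The events that `j` is the first group with an error are disjoint, so the errors of
all groups share a single `δ`. A typical group errs with probability `O(δ/k)`, which produces
`log(k/δ)`.

Both arguments rest on `law_real_mul_log_le`, a change of measure for adaptive sampling obtained by
iterating the one-sample Donsker-Varadhan inequality. -/

noncomputable section

open ProbabilityTheory

namespace CollabLearning

/-! ### Histories of an adaptive learner, call costs and a finite horizon. -/

namespace Learner

variable {T : Task}

/-- The history after one more step from `l`, when `r` holds the next oracle answers. -/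
def extend (A : Learner T) (s : A.Seed) (l : List (Fin T.n × T.Z)) (r : Fin T.n → T.Z) :
    List (Fin T.n × T.Z) :=
  match A.query s l with
  | none => l
  | some i => l ++ [(i, r i)]

theorem history_succ (A : Learner T) (s : A.Seed) (ω : ℕ → Fin T.n → T.Z) (t : ℕ) :
    A.history s ω (t + 1) = A.extend s (A.history s ω t) (ω t) := rfl

theorem length_history_le (A : Learner T) (s : A.Seed) (ω : ℕ → Fin T.n → T.Z) (t : ℕ) :
    (A.history s ω t).length ≤ t := by
  induction t with
  | zero => simp [history]
  | succ t ih =>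
    rw [history_succ, extend]
    split
    · omega
    · simpa using ih

theorem history_congr (A : Learner T) (s : A.Seed) {ω ω' : ℕ → Fin T.n → T.Z} (t : ℕ)
    (h : ∀ u < t, ω u = ω' u) : A.history s ω t = A.history s ω' t := by
  induction t with
  | zero => rfl
  | succ t ih =>
    rw [history_succ, history_succ, ih fun u hu => h u (by omega), h t (by omega)]

theorem history_stopped (A : Learner T) (s : A.Seed) (ω : ℕ → Fin T.n → T.Z) {t u : ℕ}
    (htu : t ≤ u) (h : A.query s (A.history s ω t) = none) :
    A.history s ω u = A.history s ω t := by
  induction u, htu using Nat.le_induction with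
  | base => rfl
  | succ u _ ih => rw [history_succ, extend, ih, h]

/-- The law of the oracle answers. -/
abbrev answerLaw (D : DataDistributions T) : Measure (ℕ → Fin T.n → T.Z) :=
  Measure.infinitePi fun _ : ℕ => Measure.pi D.dist

instance (A : Learner T) (D : DataDistributions T) : IsProbabilityMeasure (A.law D) := by
  unfold law; infer_instance

/-- The expected value of `f` after one more step. -/
def stepOp (A : Learner T) (s : A.Seed) (D : DataDistributions T)
    (f : List (Fin T.n × T.Z) → ℝ) (l : List (Fin T.n × T.Z)) : ℝ :=
  match A.query s l with
  | none => f l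
  | some i => ∫ z, f (l ++ [(i, z)]) ∂D.dist i

theorem measurable_query (A : Learner T) (l : List (Fin T.n × T.Z)) (o : Option (Fin T.n)) :
    MeasurableSet {s | A.query s l = o} := by
  have h := (A.query_meas l.length o).preimage
    (measurable_prodMk_right (y := fun i : Fin l.length => l.get i))
  simpa [Set.preimage, List.ofFn_getElem] using h

theorem measurable_randRisk_output (A : Learner T) (l : List (Fin T.n × T.Z)) (D : Measure T.Z)
    [IsProbabilityMeasure D] : Measurable fun s => T.randRisk D (A.output s l) := by
  have h := (A.output_meas l.length D).comp
    (measurable_prodMk_right (y := fun i : Fin l.length => l.get i))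
  simpa [Function.comp_def, List.ofFn_getElem] using h

/-- The total cost of the oracle calls in a history, when each call of oracle `i` costs `κ i`. -/
def cost (κ : Fin T.n → ℝ) (l : List (Fin T.n × T.Z)) : ℝ := (l.map fun a => κ a.1).sum

theorem cost_concat (κ : Fin T.n → ℝ) (l : List (Fin T.n × T.Z)) (i : Fin T.n) (z : T.Z) :
    cost κ (l ++ [(i, z)]) = cost κ l + κ i := by simp [cost]

theorem abs_cost_le {κ : Fin T.n → ℝ} {K : ℝ} (hK : ∀ i, |κ i| ≤ K) (l : List (Fin T.n × T.Z)) :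
    |cost κ l| ≤ l.length * K := by
  induction l with
  | nil => simp [cost]
  | cons a l ih =>
    have : cost κ (a :: l) = κ a.1 + cost κ l := by simp [cost]
    rw [this]
    have := abs_add_le (κ a.1) (cost κ l)
    have := hK a.1
    push_cast [List.length_cons]
    linarith

theorem abs_cost_le_horizon (κ : Fin T.n → ℝ) (t : ℕ) (l : List (Fin T.n × T.Z))
    (hl : l.length ≤ t) : |cost κ l| ≤ t * ∑ i, |κ i| := by
  have h0 : 0 ≤ ∑ i, |κ i| := Finset.sum_nonneg fun i _ => abs_nonneg _
  refine (abs_cost_le (fun i => Finset.single_le_sum (f := fun i => |κ i|)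
    (fun i _ => abs_nonneg _) (Finset.mem_univ i)) l).trans ?_
  exact mul_le_mul_of_nonneg_right (by exact_mod_cast hl) h0

/-- The histories at which the learner stops with an `ε`-optimal output. -/
def successSet (A : Learner T) (D : DataDistributions T) (ε : ℝ) (s : A.Seed) :
    Set (List (Fin T.n × T.Z)) :=
  {l | A.query s l = none ∧ D.IsOptimal ε (A.output s l)}

theorem successEvent_eq_iUnion (A : Learner T) (D : DataDistributions T) (ε : ℝ) :
    A.successEvent D ε = ⋃ t, {a | A.history a.1 a.2 t ∈ A.successSet D ε a.1} := by
  ext a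
  simp [successEvent, successSet]

theorem measurableSet_isOptimal (A : Learner T) (D : DataDistributions T) (ε : ℝ)
    (l : List (Fin T.n × T.Z)) : MeasurableSet {s | D.IsOptimal ε (A.output s l)} :=
  measurableSet_le (Measurable.iSup fun i => A.measurable_randRisk_output l (D.dist i))
    measurable_const

theorem measurableSet_mem_successSet (A : Learner T) (D : DataDistributions T) (ε : ℝ)
    (l : List (Fin T.n × T.Z)) : MeasurableSet {s | l ∈ A.successSet D ε s} :=
  (A.measurable_query l none).inter (A.measurableSet_isOptimal D ε l)

theorem monotone_success (A : Learner T) (D : DataDistributions T) (ε : ℝ) :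
    Monotone fun t => {a : A.Seed × (ℕ → Fin T.n → T.Z) |
      A.history a.1 a.2 t ∈ A.successSet D ε a.1} := by
  intro t u htu a ha
  have : A.history a.1 a.2 u = A.history a.1 a.2 t := A.history_stopped _ _ htu ha.1
  change A.history a.1 a.2 u ∈ A.successSet D ε a.1
  rw [this]
  exact ha

/-- A horizon by which the learner has succeeded with probability `p`, for finitely many data
distributions at a time. -/
theorem exists_horizon (A : Learner T) {ι : Type*} [Finite ι] (D : ι → DataDistributions T)
    {ε δ p : ℝ} (hp : p < 1 - δ) (hp0 : 0 ≤ p)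
    (h : ∀ σ, ENNReal.ofReal (1 - δ) ≤ A.law (D σ) (A.successEvent (D σ) ε)) :
    ∃ t, ∀ σ, p ≤
      (A.law (D σ)).real {a | A.history a.1 a.2 t ∈ A.successSet (D σ) ε a.1} := by
  have hσ : ∀ σ, ∀ᶠ t in Filter.atTop, p ≤
      (A.law (D σ)).real {a | A.history a.1 a.2 t ∈ A.successSet (D σ) ε a.1} := by
    intro σ
    have ht := tendsto_measure_iUnion_atTop (μ := A.law (D σ)) (A.monotone_success (D σ) ε)
    rw [← successEvent_eq_iUnion] at ht
    -- The success probabilities at time `t` increase to a limit that may equal `1 - δ`, so a finite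
    -- time reaches only a strictly smaller `p`.
    have hlt : ENNReal.ofReal p < A.law (D σ) (A.successEvent (D σ) ε) :=
      ((ENNReal.ofReal_lt_ofReal_iff (by linarith)).2 hp).trans_le (h σ)
    filter_upwards [ht.eventually (lt_mem_nhds hlt)] with t htt
    have := ENNReal.toReal_mono (measure_ne_top _ _) htt.le
    rwa [ENNReal.toReal_ofReal hp0] at this
  exact (Filter.eventually_all.2 hσ).exists

/-! ### Change of measure for adaptive sampling from a finite data space. -/

section Discrete

variable [Finite T.Z] [DiscreteMeasurableSpace T.Z]

/-- Histories carry the discrete σ-algebra. -/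
abbrev historySpace : MeasurableSpace (List (Fin T.n × T.Z)) := ⊤

attribute [local instance] historySpace

instance : DiscreteMeasurableSpace (List (Fin T.n × T.Z)) := ⟨fun _ => trivial⟩

theorem measurable_extend (A : Learner T) : Measurable
    fun a : A.Seed × List (Fin T.n × T.Z) × (Fin T.n → T.Z) => A.extend a.1 a.2.1 a.2.2 := by
  refine measurable_from_prod_countable_left fun ⟨l, r⟩ => ?_
  let _ : MeasurableSpace (Option (Fin T.n)) := ⊤
  have : Measurable fun s => A.query s l := measurable_to_countable' fun o => A.measurable_query l o
  have hg : Measurable fun o : Option (Fin T.n) =>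
      (match o with | none => l | some i => l ++ [(i, r i)] : List (Fin T.n × T.Z)) :=
    measurable_from_top
  exact hg.comp this

theorem measurable_history (A : Learner T) (t : ℕ) : Measurable
    fun a : A.Seed × (ℕ → Fin T.n → T.Z) => A.history a.1 a.2 t := by
  induction t with
  | zero => exact measurable_const
  | succ t ih =>
    exact A.measurable_extend.comp
      (measurable_fst.prodMk (ih.prodMk ((measurable_pi_apply t).comp measurable_snd)))

theorem measurable_history_right (A : Learner T) (s : A.Seed) (t : ℕ) :
    Measurable fun ω => A.history s ω t :=
  (A.measurable_history t).comp measurable_prodMk_left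

/-- For a fixed seed, the history after `t` steps reads only the answers of the steps before `t`. -/
theorem indepFun_history (A : Learner T) (s : A.Seed) (D : DataDistributions T) (t : ℕ) :
    IndepFun (fun ω => A.history s ω t) (fun ω => ω t) (answerLaw D) := by
  classical
  obtain ⟨z⟩ : Nonempty T.Z := by
    have := D.isProb ⟨0, T.n_pos⟩
    exact (D.dist ⟨0, T.n_pos⟩).nonempty_of_neZero
  have h := (iIndepFun_infinitePi (P := fun _ : ℕ => Measure.pi D.dist)
    (X := fun _ x => x) fun _ => measurable_id).indepFun_finset
      (Finset.range t) {t} (by simp) fun i => measurable_pi_apply i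
  -- The filler `z` at steps from `t` on is never read.
  let φ : ((i : Finset.range t) → Fin T.n → T.Z) → List (Fin T.n × T.Z) := fun x =>
    A.history s (fun u => if hu : u ∈ Finset.range t then x ⟨u, hu⟩ else fun _ => z) t
  have h2 := h.comp (φ := φ) (ψ := fun x => x ⟨t, by simp⟩) (Measurable.of_discrete)
    (Measurable.of_discrete)
  refine (show (fun ω => A.history s ω t) = _ from ?_) ▸ h2
  funext ω
  refine A.history_congr s t fun u hu => ?_
  simp [hu]

theorem integrable_history (A : Learner T) (s : A.Seed) (D : DataDistributions T) (t : ℕ)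
    (f : List (Fin T.n × T.Z) → ℝ) :
    Integrable (fun ω => f (A.history s ω t)) (answerLaw D) := by
  have hfin := (List.finite_length_le (Fin T.n × T.Z) t).image fun l => ‖f l‖
  obtain ⟨C, hC⟩ := hfin.bddAbove
  refine Integrable.of_bound
    ((Measurable.of_discrete (f := f)).comp (A.measurable_history_right s t)).aestronglyMeasurable
    C (.of_forall fun ω => hC ⟨_, A.length_history_le s ω t, rfl⟩)

theorem integral_history_succ (A : Learner T) (s : A.Seed) (D : DataDistributions T) (t : ℕ)
    (f : List (Fin T.n × T.Z) → ℝ) :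
    ∫ ω, f (A.history s ω (t + 1)) ∂answerLaw D =
      ∫ ω, A.stepOp s D f (A.history s ω t) ∂answerLaw D := by
  have hm := A.measurable_history_right s t
  have hmap := (indepFun_iff_map_prod_eq_prod_map_map hm.aemeasurable
    (measurable_pi_apply t).aemeasurable).1 (A.indepFun_history s D t)
  have hev : Measure.map (fun ω : ℕ → Fin T.n → T.Z => ω t) (answerLaw D) = Measure.pi D.dist :=
    (measurePreserving_eval_infinitePi (fun _ : ℕ => Measure.pi D.dist) t).map_eq
  rw [hev] at hmap
  have hpair : Measurable fun ω : ℕ → Fin T.n → T.Z => (A.history s ω t, ω t) :=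
    hm.prodMk (measurable_pi_apply t)
  have hext : Measurable fun a : List (Fin T.n × T.Z) × (Fin T.n → T.Z) =>
      f (A.extend s a.1 a.2) := Measurable.of_discrete
  have hint : Integrable (fun a : List (Fin T.n × T.Z) × (Fin T.n → T.Z) =>
      f (A.extend s a.1 a.2)) ((Measure.map (fun ω => A.history s ω t) (answerLaw D)).prod
        (Measure.pi D.dist)) := by
    rw [← hmap, integrable_map_measure hext.aestronglyMeasurable hpair.aemeasurable]
    exact A.integrable_history s D (t + 1) f
  have := Measure.isProbabilityMeasure_map (μ := answerLaw D) hm.aemeasurable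
  calc ∫ ω, f (A.history s ω (t + 1)) ∂answerLaw D
      = ∫ a, f (A.extend s a.1 a.2)
          ∂Measure.map (fun ω => (A.history s ω t, ω t)) (answerLaw D) := by
        rw [integral_map hpair.aemeasurable hext.aestronglyMeasurable]; rfl
    _ = ∫ l, ∫ r, f (A.extend s l r) ∂Measure.pi D.dist
          ∂Measure.map (fun ω => A.history s ω t) (answerLaw D) := by
        rw [hmap, integral_prod _ hint]
    _ = ∫ l, A.stepOp s D f l ∂Measure.map (fun ω => A.history s ω t) (answerLaw D) := by
        congr 1
        funext l
        unfold extend stepOp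
        cases A.query s l with
        | none => simp
        | some i =>
          have hp := measurePreserving_eval D.dist i
          have := integral_map (μ := Measure.pi D.dist) hp.measurable.aemeasurable
            (f := fun z => f (l ++ [(i, z)])) (Measurable.of_discrete).aestronglyMeasurable
          rw [hp.map_eq] at this
          exact this.symm
    _ = _ := integral_map hm.aemeasurable (Measurable.of_discrete).aestronglyMeasurable

theorem integral_history (A : Learner T) (s : A.Seed) (D : DataDistributions T) (t : ℕ)
    (f : List (Fin T.n × T.Z) → ℝ) :
    ∫ ω, f (A.history s ω t) ∂answerLaw D = (A.stepOp s D)^[t] f [] := by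
  induction t generalizing f with
  | zero => simp [history]
  | succ t ih => rw [integral_history_succ, ih, Function.iterate_succ_apply]

/-- Keeps the iterates within the range `1 ≤ W` in which the one-sample inequality is assumed. -/
theorem one_le_iterate_stepOp (A : Learner T) (s : A.Seed) (D : DataDistributions T)
    {W : List (Fin T.n × T.Z) → ℝ} (hW : ∀ l, 1 ≤ W l) (t : ℕ) (l : List (Fin T.n × T.Z)) :
    1 ≤ (A.stepOp s D)^[t] W l := by
  induction t generalizing l with
  | zero => exact hW l
  | succ t ih =>
    rw [Function.iterate_succ_apply', stepOp]
    split
    · exact ih l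
    · rename_i i _
      calc (1 : ℝ) = ∫ _, (1 : ℝ) ∂D.dist i := by simp
        _ ≤ _ := integral_mono .of_finite .of_finite fun z => ih _

/-- The Donsker-Varadhan inequality for the law of the history, derived from that for
single data points. -/
theorem iterate_stepOp_log_le (A : Learner T) (s : A.Seed) (D D' : DataDistributions T)
    (κ : Fin T.n → ℝ)
    (hκ : ∀ i (W : T.Z → ℝ), (∀ z, 1 ≤ W z) →
      ∫ z, Real.log (W z) ∂D.dist i ≤ κ i + Real.log (∫ z, W z ∂D'.dist i))
    {W : List (Fin T.n × T.Z) → ℝ} (hW : ∀ l, 1 ≤ W l) (t : ℕ) (l : List (Fin T.n × T.Z)) :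
    (A.stepOp s D)^[t] (fun l => Real.log (W l)) l ≤
      Real.log ((A.stepOp s D')^[t] W l) + ((A.stepOp s D)^[t] (cost κ) l - cost κ l) := by
  induction t generalizing l with
  | zero => simp
  | succ t ih =>
    simp only [Function.iterate_succ_apply']
    set P := (A.stepOp s D)^[t] (fun l => Real.log (W l)) with hP
    set Q := (A.stepOp s D')^[t] W with hQ
    set C := (A.stepOp s D)^[t] (cost κ) with hC
    unfold stepOp
    cases A.query s l with
    | none => exact ih l
    | some i =>
      have h1 : ∫ z, P (l ++ [(i, z)]) ∂D.dist i ≤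
          ∫ z, (Real.log (Q (l ++ [(i, z)])) + (C (l ++ [(i, z)]) - (cost κ l + κ i)))
            ∂D.dist i := by
        refine integral_mono .of_finite .of_finite fun z => ?_
        have := ih (l ++ [(i, z)])
        rwa [cost_concat] at this
      rw [integral_add .of_finite .of_finite, integral_sub .of_finite .of_finite] at h1
      -- Chain rule: the one-sample inequality for the next call is applied to the conditional
      -- expectation of `W` after it, and adds `κ i` to the cost.
      have h2 := hκ i (fun z => Q (l ++ [(i, z)])) fun z => A.one_le_iterate_stepOp s D' hW t _
      simp only [integral_const, probReal_univ, one_smul] at h1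
      simp only
      linarith

theorem integrable_seed_history (A : Learner T) (D : DataDistributions T) (t : ℕ)
    {F : A.Seed → List (Fin T.n × T.Z) → ℝ} (hF : ∀ l, Measurable fun s => F s l) {C : ℝ}
    (hC : ∀ s l, l.length ≤ t → |F s l| ≤ C) :
    Integrable (fun a => F a.1 (A.history a.1 a.2 t)) (A.law D) := by
  have h1 : Measurable fun p : A.Seed × List (Fin T.n × T.Z) => F p.1 p.2 :=
    measurable_from_prod_countable_left hF
  exact Integrable.of_bound
    (h1.comp (measurable_fst.prodMk (A.measurable_history t))).aestronglyMeasurable C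
    (.of_forall fun a => hC _ _ (A.length_history_le _ _ _))

theorem integral_law (A : Learner T) (D : DataDistributions T) (t : ℕ)
    {F : A.Seed → List (Fin T.n × T.Z) → ℝ} (hF : ∀ l, Measurable fun s => F s l) {C : ℝ}
    (hC : ∀ s l, l.length ≤ t → |F s l| ≤ C) :
    Integrable (fun s => ∫ ω, F s (A.history s ω t) ∂answerLaw D) A.seedLaw ∧
    ∫ a, F a.1 (A.history a.1 a.2 t) ∂A.law D =
      ∫ s, ∫ ω, F s (A.history s ω t) ∂answerLaw D ∂A.seedLaw := by
  have h := A.integrable_seed_history D t hF hC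
  exact ⟨Integrable.integral_prod_left h, integral_prod _ h⟩

theorem measurableSet_history_mem (A : Learner T) (t : ℕ)
    {E : A.Seed → Set (List (Fin T.n × T.Z))} (hE : ∀ l, MeasurableSet {s | l ∈ E s}) :
    MeasurableSet {a : A.Seed × (ℕ → Fin T.n → T.Z) | A.history a.1 a.2 t ∈ E a.1} := by
  have : MeasurableSet {p : A.Seed × List (Fin T.n × T.Z) | p.2 ∈ E p.1} := by
    have h : Measurable fun p : A.Seed × List (Fin T.n × T.Z) => p.2 ∈ E p.1 :=
      measurable_from_prod_countable_left fun l => measurableSet_setOfPred.1 (hE l)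
    exact measurableSet_setOfPred.2 h
  exact this.preimage (measurable_fst.prodMk (A.measurable_history t))

theorem integrable_cost (A : Learner T) (D : DataDistributions T) (κ : Fin T.n → ℝ) (t : ℕ) :
    Integrable (fun a => cost κ (A.history a.1 a.2 t)) (A.law D) :=
  A.integrable_seed_history D t (F := fun _ l => cost κ l) (fun _ => measurable_const)
    fun _ l hl => abs_cost_le_horizon κ t l hl

/-- Change of measure: an event that depends on the history and is likely under `D` and unlikely
under `D'` forces a large cost under `D`. -/
theorem law_real_mul_log_le (A : Learner T) (D D' : DataDistributions T) (κ : Fin T.n → ℝ)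
    (hκ : ∀ i (W : T.Z → ℝ), (∀ z, 1 ≤ W z) →
      ∫ z, Real.log (W z) ∂D.dist i ≤ κ i + Real.log (∫ z, W z ∂D'.dist i))
    (t : ℕ) {E : A.Seed → Set (List (Fin T.n × T.Z))} (hE : ∀ l, MeasurableSet {s | l ∈ E s})
    {x : ℝ} (hx : 0 < x) (hx1 : x ≤ 1) :
    (A.law D).real {a | A.history a.1 a.2 t ∈ E a.1} * Real.log (1 / x) ≤
      Real.log 2 + ((A.law D').real {a | A.history a.1 a.2 t ∈ E a.1} / x - 1) / 2 +
        ∫ a, cost κ (A.history a.1 a.2 t) ∂A.law D := by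
  classical
  let F : A.Seed → List (Fin T.n × T.Z) → ℝ := fun s l => if l ∈ E s then 1 else 0
  have hF : ∀ l, Measurable fun s => F s l := fun l =>
    Measurable.ite (hE l) measurable_const measurable_const
  have hF1 : ∀ s l, l.length ≤ t → |F s l| ≤ 1 := fun s l _ => by
    by_cases h : l ∈ E s <;> simp [F, h]
  have hreal : ∀ D : DataDistributions T,
      (A.law D).real {a | A.history a.1 a.2 t ∈ E a.1} =
        ∫ a, F a.1 (A.history a.1 a.2 t) ∂A.law D := fun D => by
    rw [← integral_indicator_one (A.measurableSet_history_mem t hE)]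
    rfl
  obtain ⟨hi1, he1⟩ := A.integral_law D t hF hF1
  obtain ⟨hi2, he2⟩ := A.integral_law D' t hF hF1
  obtain ⟨hi3, he3⟩ := A.integral_law D t (F := fun _ l => cost κ l) (fun _ => measurable_const)
    fun _ l hl => abs_cost_le_horizon κ t l hl
  rw [hreal, hreal, he1, he2, he3]
  have hseed : ∀ s, (∫ ω, F s (A.history s ω t) ∂answerLaw D) * Real.log (1 / x) ≤
      Real.log 2 + ((∫ ω, F s (A.history s ω t) ∂answerLaw D') / x - 1) / 2 +
        ∫ ω, cost κ (A.history s ω t) ∂answerLaw D := by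
    intro s
    have hx' : 1 ≤ 1 / x := by rw [le_div_iff₀ hx]; linarith
    -- `W` is `1 / x` on the event and `1` off it, so `log W` is a multiple of the indicator.
    let W : List (Fin T.n × T.Z) → ℝ := fun l => 1 + F s l * (1 / x - 1)
    have hW : ∀ l, 1 ≤ W l := fun l => by
      by_cases h : l ∈ E s <;> simp [W, F, h]
      simpa using hx'
    have hlog : ∀ l, Real.log (W l) = F s l * Real.log (1 / x) := fun l => by
      by_cases h : l ∈ E s <;> simp [W, F, h]
    have key := A.iterate_stepOp_log_le s D D' κ hκ hW t []
    rw [← integral_history, ← integral_history, ← integral_history] at key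
    simp only [hlog, integral_mul_const] at key
    have hWi : ∫ ω, W (A.history s ω t) ∂answerLaw D' =
        1 + (∫ ω, F s (A.history s ω t) ∂answerLaw D') * (1 / x - 1) := by
      rw [integral_add (integrable_const _)
        ((A.integrable_history s D' t (F s)).mul_const _), integral_mul_const]
      simp
    have hq0 : 0 ≤ ∫ ω, F s (A.history s ω t) ∂answerLaw D' :=
      integral_nonneg fun ω => by by_cases h : A.history s ω t ∈ E s <;> simp [F, h]
    rw [hWi] at key
    set q := ∫ ω, F s (A.history s ω t) ∂answerLaw D'
    have hpos : 0 < 1 + q * (1 / x - 1) := by nlinarith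
    -- The tangent of the logarithm at `2` makes the bound affine in `q`, so it can be averaged over
    -- seeds here and over problems later.
    have hl := Real.log_le_sub_one_of_pos (show 0 < (1 + q * (1 / x - 1)) / 2 by positivity)
    rw [Real.log_div hpos.ne' (by norm_num)] at hl
    have hc : cost κ ([] : List (Fin T.n × T.Z)) = 0 := by simp [cost]
    have : q / x = q * (1 / x) := by ring
    rw [hc] at key
    rw [this]
    nlinarith
  calc _ = ∫ s, (∫ ω, F s (A.history s ω t) ∂answerLaw D) * Real.log (1 / x) ∂A.seedLaw := by
        rw [integral_mul_const]
    _ ≤ ∫ s, (Real.log 2 + ((∫ ω, F s (A.history s ω t) ∂answerLaw D') / x - 1) / 2 +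
        ∫ ω, cost κ (A.history s ω t) ∂answerLaw D) ∂A.seedLaw := by
        refine integral_mono (hi1.mul_const _) ?_ hseed
        exact ((integrable_const _).add
          (((hi2.div_const _).sub (integrable_const _)).div_const _)).add hi3
    _ = _ := by
        have h2 := (((hi2.div_const x).sub (integrable_const (1 : ℝ))).div_const 2)
        have e1 := integral_add ((integrable_const (Real.log 2)).add h2) hi3
        have e2 := integral_add (integrable_const (μ := A.seedLaw) (Real.log 2)) h2
        have e3 := integral_sub (hi2.div_const x) (integrable_const (1 : ℝ))
        simp only [Pi.add_apply, Pi.sub_apply, integral_div, integral_const, probReal_univ,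
          one_smul] at e1 e2 e3
        rw [e1, e2, e3]

theorem integral_length_le (A : Learner T) (D : DataDistributions T) (t : ℕ)
    (h : A.expectedSamples D ≠ ⊤) :
    ∫ a, ((A.history a.1 a.2 t).length : ℝ) ∂A.law D ≤ (A.expectedSamples D).toReal := by
  have hm : Measurable fun a : A.Seed × (ℕ → Fin T.n → T.Z) =>
      ((A.history a.1 a.2 t).length : ℝ) :=
    (Measurable.of_discrete (f := fun l : List (Fin T.n × T.Z) => (l.length : ℝ))).comp
      (A.measurable_history t)
  have h0 : 0 ≤ᵐ[A.law D] fun a => ((A.history a.1 a.2 t).length : ℝ) :=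
    .of_forall fun a => Nat.cast_nonneg _
  rw [integral_eq_lintegral_of_nonneg_ae h0 hm.aestronglyMeasurable]
  refine ENNReal.toReal_mono h (lintegral_mono fun a => ?_)
  simp only [ENNReal.ofReal_natCast]
  exact le_iSup (fun t => ((A.history a.1 a.2 t).length : ℝ≥0∞)) t

/-- An event on which the learner stops without success has probability at most `δ`. -/
theorem law_real_le_of_disjoint (A : Learner T) (D : DataDistributions T) {ε δ : ℝ}
    (h : ENNReal.ofReal (1 - δ) ≤ A.law D (A.successEvent D ε)) (t : ℕ)
    {E : A.Seed → Set (List (Fin T.n × T.Z))} (hE : ∀ l, MeasurableSet {s | l ∈ E s})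
    (hfinal : ∀ s, ∀ l ∈ E s, A.query s l = none ∧ ¬ D.IsOptimal ε (A.output s l)) :
    (A.law D).real {a | A.history a.1 a.2 t ∈ E a.1} ≤ δ := by
  have hd : Disjoint (A.successEvent D ε) {a | A.history a.1 a.2 t ∈ E a.1} := by
    rw [Set.disjoint_left]
    rintro a ⟨u, hu, hopt⟩ ha
    obtain ⟨h1, h2⟩ := hfinal _ _ ha
    have : A.history a.1 a.2 u = A.history a.1 a.2 t := by
      rcases le_total t u with htu | htu
      · exact A.history_stopped _ _ htu h1
      · exact (A.history_stopped _ _ htu hu).symm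
    rw [this] at hopt
    exact h2 hopt
  have hu := measureReal_union (μ := A.law D) hd (A.measurableSet_history_mem t hE)
  have h1 : (A.law D).real (A.successEvent D ε ∪ {a | A.history a.1 a.2 t ∈ E a.1}) ≤ 1 :=
    measureReal_le_one
  have h2 : 1 - δ ≤ (A.law D).real (A.successEvent D ε) := by
    have := ENNReal.toReal_mono (measure_ne_top _ _) h
    rw [ENNReal.toReal_ofReal'] at this
    exact (le_max_left _ _).trans this
  linarith

end Discrete

end Learner

/-! ### The one-sample inequality, with the chi-square divergence in place of relative entropy. -/

/-- The Donsker-Varadhan inequality on a finite type. -/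
theorem sum_mul_log_le {ι : Type*} [Fintype ι] [Nonempty ι] {p q W : ι → ℝ} (hp : ∀ x, 0 < p x)
    (hq : ∀ x, 0 < q x) (hp1 : ∑ x, p x = 1) (hW : ∀ x, 1 ≤ W x) :
    ∑ x, p x * Real.log (W x) ≤ (∑ x, p x ^ 2 / q x - 1) + Real.log (∑ x, q x * W x) := by
  have hW0 : ∀ x, 0 < W x := fun x => zero_lt_one.trans_le (hW x)
  set c := ∑ x, q x * W x with hc
  have hc0 : 0 < c := Finset.sum_pos (fun x _ => mul_pos (hq x) (hW0 x)) Finset.univ_nonempty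
  -- Split `log W = log (p/q) + log (qW/(pc)) + log c` and use `log y ≤ y - 1` on the first two
  -- terms; the second then sums to zero.
  have key : ∀ x, p x * Real.log (W x) ≤
      (p x ^ 2 / q x - p x) + (q x * W x / c - p x) + p x * Real.log c := by
    intro x
    have h1 := Real.log_le_sub_one_of_pos (div_pos (hp x) (hq x))
    have h2 := Real.log_le_sub_one_of_pos
      (div_pos (mul_pos (div_pos (hq x) (hp x)) (hW0 x)) hc0)
    rw [Real.log_div (mul_pos (div_pos (hq x) (hp x)) (hW0 x)).ne' hc0.ne',
      Real.log_mul (div_pos (hq x) (hp x)).ne' (hW0 x).ne',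
      Real.log_div (hq x).ne' (hp x).ne'] at h2
    rw [Real.log_div (hp x).ne' (hq x).ne'] at h1
    have e1 : p x * (p x / q x - 1) = p x ^ 2 / q x - p x := by ring
    have e2 : p x * (q x / p x * W x / c - 1) = q x * W x / c - p x := by
      have := (hp x).ne'
      field_simp
    have h3 := mul_le_mul_of_nonneg_left h1 (hp x).le
    have h4 := mul_le_mul_of_nonneg_left h2 (hp x).le
    rw [e1] at h3
    rw [e2] at h4
    linarith
  refine (Finset.sum_le_sum fun x _ => key x).trans ?_
  rw [Finset.sum_add_distrib, Finset.sum_add_distrib, Finset.sum_sub_distrib,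
    Finset.sum_sub_distrib, ← Finset.sum_div, ← Finset.sum_mul, hp1, ← hc, div_self hc0.ne']
  linarith

/-! ### Problems built from coin tosses with at most one biased coin per oracle. -/

section Coins

variable {K : Type}

/-- The sign `±1` of a coin toss. -/
def sign (b : Bool) : ℝ := if b then 1 else -1

/-- The density of a vector of independent coin tosses that are fair, except for the coin
singled out by `θ`, which has bias `β`, with respect to tosses that are all fair. -/
def tilt (β : ℝ) (θ : Option K) (η : K → Bool) : ℝ :=
  match θ with
  | none => 1
  | some κ => 1 + β * sign (η κ)

theorem tilt_pos {β : ℝ} (hβ : |β| ≤ 3 / 4) (θ : Option K) (η : K → Bool) :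
    0 < tilt β θ η := by
  have := abs_le.1 hβ
  cases θ with
  | none => simp [tilt]
  | some κ => cases h : η κ <;> simp [tilt, sign, h] <;> linarith

variable [Fintype K] [DecidableEq K]

/-- The probability of each outcome of fair tosses of the coins in `K`. -/
def fairWeight (K : Type) [Fintype K] [DecidableEq K] : ℝ := (Fintype.card (K → Bool) : ℝ)⁻¹

theorem fairWeight_pos : 0 < fairWeight K := inv_pos.2 (by exact_mod_cast Fintype.card_pos)

theorem sum_fairWeight : ∑ _η : K → Bool, fairWeight K = 1 := by
  rw [Finset.sum_const, Finset.card_univ, nsmul_eq_mul, fairWeight, mul_inv_cancel₀]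
  exact_mod_cast Fintype.card_ne_zero

/-- Flipping coin `κ` is an involution that negates every summand. -/
theorem sum_sign_mul_eq_zero (κ : K) (g : (K → Bool) → ℝ)
    (hg : ∀ η, g (Function.update η κ (!η κ)) = g η) : ∑ η, sign (η κ) * g η = 0 := by
  have hinv : Function.Involutive fun η : K → Bool => Function.update η κ (!η κ) := by
    intro η
    simp
  let e : Equiv.Perm (K → Bool) := hinv.toPerm _
  have h := Equiv.sum_comp e fun η => sign (η κ) * g η
  have h2 : ∀ η, sign (e η κ) * g (e η) = -(sign (η κ) * g η) := by
    intro η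
    have : e η = Function.update η κ (!η κ) := rfl
    rw [this, hg]
    cases h : η κ <;> simp [sign]
  simp only [h2, Finset.sum_neg_distrib] at h
  linarith

theorem sum_sign (κ : K) : ∑ η : K → Bool, sign (η κ) = 0 := by
  simpa using sum_sign_mul_eq_zero κ (fun _ => 1) fun _ => rfl

theorem sum_sign_mul_sign (κ κ' : K) :
    fairWeight K * ∑ η : K → Bool, sign (η κ) * sign (η κ') = if κ = κ' then 1 else 0 := by
  split_ifs with h
  · subst h
    have : ∀ η : K → Bool, sign (η κ) * sign (η κ) = 1 := fun η => by
      cases η κ <;> simp [sign]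
    simp only [this, Finset.mul_sum, mul_one]
    exact sum_fairWeight
  · rw [sum_sign_mul_eq_zero, mul_zero]
    intro η
    rw [Function.update_of_ne (Ne.symm h)]

theorem sum_fairWeight_mul_tilt (β : ℝ) (θ : Option K) :
    ∑ η, fairWeight K * tilt β θ η = 1 := by
  cases θ with
  | none => simpa [tilt] using sum_fairWeight (K := K)
  | some κ =>
    simp only [tilt, mul_add, mul_one, Finset.sum_add_distrib, sum_fairWeight]
    rw [← Finset.mul_sum, ← Finset.mul_sum, sum_sign]
    simp

theorem sum_tilt_mul_bit (β : ℝ) (θ : Option K) (κ : K) :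
    ∑ η : K → Bool, fairWeight K * tilt β θ η * (if η κ then 1 else 0) =
      1 / 2 + β / 2 * (if θ = some κ then 1 else 0) := by
  have hbit : ∀ η : K → Bool, (if η κ then 1 else 0 : ℝ) = 1 / 2 + sign (η κ) / 2 := fun η => by
    cases η κ <;> simp [sign] <;> norm_num
  have hcorr : fairWeight K * ∑ η, tilt β θ η * sign (η κ) =
      β * (if θ = some κ then 1 else 0) := by
    cases θ with
    | none => simp [tilt, sum_sign]
    | some κ' =>
      have : ∑ η : K → Bool, tilt β (some κ') η * sign (η κ) =
          β * ∑ η : K → Bool, sign (η κ') * sign (η κ) := by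
        simp only [tilt, add_mul, one_mul, Finset.sum_add_distrib, sum_sign, zero_add,
          Finset.mul_sum, mul_assoc]
      rw [this, mul_left_comm, sum_sign_mul_sign]
      simp
  have h : ∀ η : K → Bool, fairWeight K * tilt β θ η * (1 / 2 + sign (η κ) / 2) =
      1 / 2 * (fairWeight K * tilt β θ η) +
        1 / 2 * (fairWeight K * (tilt β θ η * sign (η κ))) := fun η => by ring
  simp only [hbit, h, Finset.sum_add_distrib, ← Finset.mul_sum, hcorr]
  rw [Finset.mul_sum, sum_fairWeight_mul_tilt]
  ring

/-- An upper bound for the relative entropy of `tilt β θ` with respect to `tilt β θ'`. -/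
def tiltEntropy (β : ℝ) : Option K → Option K → ℝ
  | none, some _ => 4 * β ^ 2
  | some _, none => β ^ 2
  | _, _ => 0

theorem sum_tilt_sq_div_le {β : ℝ} (hβ : |β| ≤ 3 / 4) {θ θ' : Option K}
    (h : θ = θ' ∨ θ = none ∨ θ' = none) :
    ∑ η, (fairWeight K * tilt β θ η) ^ 2 / (fairWeight K * tilt β θ' η) - 1 ≤
      tiltEntropy β θ θ' := by
  have hw := fairWeight_pos (K := K)
  have hpos : ∀ θ : Option K, ∀ η, 0 < fairWeight K * tilt β θ η := fun θ η =>
    mul_pos hw (tilt_pos hβ θ η)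
  rcases eq_or_ne θ θ' with rfl | hne
  · have : ∀ η, (fairWeight K * tilt β θ η) ^ 2 / (fairWeight K * tilt β θ η) =
        fairWeight K * tilt β θ η := fun η => by
      rw [sq, mul_div_assoc, div_self (hpos θ η).ne', mul_one]
    simp only [this, sum_fairWeight_mul_tilt]
    cases θ <;> simp [tiltEntropy]
  cases θ with
  | none =>
    cases θ' with
    | none => exact absurd rfl hne
    | some κ =>
      have hle : ∀ η : K → Bool, (fairWeight K * tilt β none η) ^ 2 /
          (fairWeight K * tilt β (some κ) η) ≤
          fairWeight K * ((1 + 4 * β ^ 2) - β * sign (η κ)) := by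
        intro η
        have ht := tilt_pos hβ (some κ) η
        rw [div_le_iff₀ (hpos _ η)]
        have hs : sign (η κ) ^ 2 = 1 := by cases η κ <;> simp [sign]
        have hb := abs_le.1 hβ
        -- The product equals `1 + β^2 (3 + 4 β sign)`, which is at least `1` because `|β| ≤ 3/4`.
        -- The majorant of `1 / tilt` is affine in the sign, so its fair mean is immediate.
        have hmul : 1 ≤ ((1 + 4 * β ^ 2) - β * sign (η κ)) * tilt β (some κ) η := by
          simp only [tilt] at ht ⊢
          have h3 : 0 ≤ 3 + 4 * (β * sign (η κ)) := by
            cases η κ <;> simp [sign] <;> linarith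
          have := mul_nonneg (sq_nonneg β) h3
          nlinarith
        have := mul_le_mul_of_nonneg_left hmul (mul_pos hw hw).le
        simp only [tilt] at this ⊢
        nlinarith
      have hsum : ∑ η : K → Bool, fairWeight K * ((1 + 4 * β ^ 2) - β * sign (η κ)) =
          1 + 4 * β ^ 2 := by
        have : ∀ η : K → Bool, fairWeight K * ((1 + 4 * β ^ 2) - β * sign (η κ)) =
            (1 + 4 * β ^ 2) * fairWeight K - fairWeight K * β * sign (η κ) := fun η => by ring
        simp only [this, Finset.sum_sub_distrib, ← Finset.mul_sum, sum_sign, sum_fairWeight]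
        ring
      have := Finset.sum_le_sum fun η (_ : η ∈ Finset.univ) => hle η
      rw [hsum] at this
      simp only [tiltEntropy]
      linarith
  | some κ =>
    obtain rfl : θ' = none := by
      rcases h with h | h | h
      · exact absurd h hne
      · simp at h
      · exact h
    have hs : ∀ η : K → Bool, (fairWeight K * tilt β (some κ) η) ^ 2 /
        (fairWeight K * tilt β none η) =
        (1 + β ^ 2) * fairWeight K + 2 * fairWeight K * β * sign (η κ) := fun η => by
      have : sign (η κ) ^ 2 = 1 := by cases η κ <;> simp [sign]
      simp only [tilt]
      field_simp
      linear_combination β ^ 2 * this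
    simp only [hs, Finset.sum_add_distrib, ← Finset.mul_sum, sum_sign, sum_fairWeight,
      tiltEntropy]
    linarith

/-- Coin tosses that are fair except for the coin singled out by `θ`, which has bias `β`. -/
def coinPMF {β : ℝ} (hβ : |β| ≤ 3 / 4) (θ : Option K) : PMF (K → Bool) :=
  PMF.ofFintype (fun η => ENNReal.ofReal (fairWeight K * tilt β θ η)) <| by
    rw [← ENNReal.ofReal_sum_of_nonneg fun η _ =>
      (mul_pos fairWeight_pos (tilt_pos hβ θ η)).le, sum_fairWeight_mul_tilt, ENNReal.ofReal_one]

variable {n d : ℕ}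

/-- A label is a hypothesis code together with an oracle index and a vector of coin tosses. -/
abbrev CoinLabel (n d : ℕ) (K : Type) : Type := (Fin d → Bool) × (Fin n × (K → Bool))

/-- The task in which hypothesis `v` suffers at oracle `i` the toss of coin `sel v i`. -/
def coinTask (hn : 0 < n) (sel : (Fin d → Bool) → Fin n → K) : Task where
  X := Unit
  Y := CoinLabel n d K
  measX := ⊤
  measY := ⊤
  n := n
  n_pos := hn
  -- Only the code in the predicted label matters, so an improper predictor is no better than a
  -- mixture of hypotheses.
  loss f z := if z.2.2.2 (sel (f.1 ()).1 z.2.2.1) then 1 else 0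
  loss_mem f z := by split_ifs <;> simp
  loss_meas f := by
    let _ : MeasurableSpace Unit := ⊤
    let _ : MeasurableSpace (CoinLabel n d K) := ⊤
    have : DiscreteMeasurableSpace (CoinLabel n d K) := ⟨fun _ => trivial⟩
    exact Measurable.of_discrete
  H := by
    let _ : MeasurableSpace Unit := ⊤
    let _ : MeasurableSpace (CoinLabel n d K) := ⊤
    exact Finset.univ.map
      ⟨fun v => (⟨fun _ => (v, (⟨0, hn⟩, fun _ => false)), measurable_const⟩ :
        Predictor Unit (CoinLabel n d K)),
        fun v w h => congrArg (fun f : Predictor Unit (CoinLabel n d K) => (f.1 ()).1) h⟩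
  H_nonempty := by simp

variable {hn : 0 < n} {sel : (Fin d → Bool) → Fin n → K}

theorem coinTask_H_card {K : Type} [Fintype K] {sel : (Fin d → Bool) → Fin n → K} :
    (coinTask hn sel).H.card = 2 ^ d := by
  refine (Finset.card_map _).trans ?_
  simp

instance : Finite (coinTask hn sel).Z :=
  inferInstanceAs (Finite (Unit × CoinLabel n d K))

instance : DiscreteMeasurableSpace (coinTask hn sel).Y := ⟨fun _ => trivial⟩

instance : DiscreteMeasurableSpace (coinTask hn sel).X := ⟨fun _ => trivial⟩

instance : Countable (coinTask hn sel).Y :=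
  inferInstanceAs (Countable (CoinLabel n d K))

instance : DiscreteMeasurableSpace (coinTask hn sel).Z :=
  have : Countable (coinTask hn sel).X := inferInstanceAs (Countable Unit)
  inferInstance

/-- The hypothesis coded by a predictor. -/
def code (f : Predictor (coinTask hn sel).X (coinTask hn sel).Y) : Fin d → Bool := (f.1 ()).1

/-- The data point in which oracle `i` reveals the coin tosses `η`. -/
def reveal (hn : 0 < n) (sel : (Fin d → Bool) → Fin n → K) (i : Fin n) (η : K → Bool) :
    (coinTask hn sel).Z :=
  ((), ((fun _ => false), (i, η)))

/-- The distribution of the answers of oracle `i` when its coins follow `θ`. -/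
def coinLaw (hn : 0 < n) (sel : (Fin d → Bool) → Fin n → K) {β : ℝ} (hβ : |β| ≤ 3 / 4)
    (i : Fin n) (θ : Option K) : Measure (coinTask hn sel).Z :=
  ((coinPMF hβ θ).map (reveal hn sel i)).toMeasure

instance instIsProbabilityMeasureCoinLaw {β : ℝ} (hβ : |β| ≤ 3 / 4) (i : Fin n) (θ : Option K) :
    IsProbabilityMeasure (coinLaw hn sel hβ i θ) := by
  unfold coinLaw; infer_instance

theorem integral_coinLaw {β : ℝ} (hβ : |β| ≤ 3 / 4) (i : Fin n) (θ : Option K)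
    (f : (coinTask hn sel).Z → ℝ) :
    ∫ z, f z ∂coinLaw hn sel hβ i θ =
      ∑ η, fairWeight K * tilt β θ η * f (reveal hn sel i η) := by
  have hmeas : Measurable (reveal hn sel i) := Measurable.of_discrete
  rw [coinLaw, ← PMF.toMeasure_map _ _ hmeas, integral_map hmeas.aemeasurable
    (Measurable.of_discrete).aestronglyMeasurable, PMF.integral_eq_sum]
  refine Finset.sum_congr rfl fun η _ => ?_
  rw [smul_eq_mul, coinPMF, PMF.ofFintype_apply,
    ENNReal.toReal_ofReal (mul_pos fairWeight_pos (tilt_pos hβ θ η)).le]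

/-- The problem in which the coins of oracle `i` follow `θ i`. -/
def coinData (hn : 0 < n) (sel : (Fin d → Bool) → Fin n → K) {β : ℝ} (hβ : |β| ≤ 3 / 4)
    (θ : Fin n → Option K) : DataDistributions (coinTask hn sel) where
  dist i := coinLaw hn sel hβ i (θ i)
  isProb i := instIsProbabilityMeasureCoinLaw hβ i (θ i)
  injective i j hij := by
    change Fin n at i j
    by_contra hne
    -- The oracle index stored in the label keeps the `n` distributions distinct even when their
    -- coins have the same law.
    have h := congrArg (fun μ : Measure (coinTask hn sel).Z =>
      ∫ z, (if z.2.2.1 = i then 1 else 0 : ℝ) ∂μ) hij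
    simp only [integral_coinLaw] at h
    have hne' : j ≠ i := fun h => hne h.symm
    simp [reveal, hne', sum_fairWeight_mul_tilt] at h

/-- The probability that a randomized predictor assigns to a property. -/
def mass {α : Type*} (p : PMF α) (P : α → Prop) [DecidablePred P] : ℝ :=
  ∑' f, (p f).toReal * (if P f then 1 else 0)

section Mass

variable {α : Type*} (p : PMF α)

theorem summable_toReal : Summable fun f => (p f).toReal :=
  ENNReal.summable_toReal p.tsum_coe_ne_top

theorem tsum_toReal : ∑' f, (p f).toReal = 1 := by
  rw [← ENNReal.tsum_toReal_eq p.apply_ne_top, p.tsum_coe, ENNReal.toReal_one]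

theorem summable_mass (P : α → Prop) [DecidablePred P] :
    Summable fun f => (p f).toReal * (if P f then 1 else 0 : ℝ) := by
  refine Summable.of_nonneg_of_le (fun f => ?_) (fun f => ?_) (summable_toReal p)
  · split_ifs <;> simp
  · split_ifs <;> simp

theorem one_le_mass_add_mass (P Q : α → Prop) [DecidablePred P] [DecidablePred Q]
    (h : ∀ f, P f ∨ Q f) : 1 ≤ mass p P + mass p Q := by
  refine (tsum_toReal p).symm.le.trans ?_
  rw [mass, mass, ← (summable_mass p P).tsum_add (summable_mass p Q)]
  refine (summable_toReal p).tsum_le_tsum (fun f => ?_)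
    ((summable_mass p P).add (summable_mass p Q))
  rcases h f with h | h <;> simp only [h, if_true, mul_one] <;> split_ifs <;> simp

theorem mass_add_mass_le_one (P Q : α → Prop) [DecidablePred P] [DecidablePred Q]
    (h : ∀ f, P f → ¬ Q f) : mass p P + mass p Q ≤ 1 := by
  refine le_trans ?_ (tsum_toReal p).le
  rw [mass, mass, ← (summable_mass p P).tsum_add (summable_mass p Q)]
  refine ((summable_mass p P).add (summable_mass p Q)).tsum_le_tsum (fun f => ?_)
    (summable_toReal p)
  by_cases hP : P f
  · simp [hP, h f hP]
  · split_ifs <;> simp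

end Mass

section Risk

variable {β : ℝ} (hβ : |β| ≤ 3 / 4) (θ : Fin n → Option K)

theorem risk_coinData (i : Fin n) (f : Predictor (coinTask hn sel).X (coinTask hn sel).Y) :
    (coinTask hn sel).risk ((coinData hn sel hβ θ).dist i) f =
      1 / 2 + β / 2 * (if θ i = some (sel (code f) i) then 1 else 0) := by
  have h := integral_coinLaw (hn := hn) (sel := sel) hβ i (θ i) ((coinTask hn sel).loss f)
  refine h.trans ?_
  rw [← sum_tilt_mul_bit]
  rfl

theorem randRisk_coinData (i : Fin n)
    (p : PMF (Predictor (coinTask hn sel).X (coinTask hn sel).Y)) :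
    (coinTask hn sel).randRisk ((coinData hn sel hβ θ).dist i) p =
      1 / 2 + β / 2 * mass p fun f => θ i = some (sel (code f) i) := by
  have h1 := (summable_toReal p).mul_left (1 / 2)
  have h2 := (summable_mass p fun f => θ i = some (sel (code f) i)).mul_left (β / 2)
  calc (coinTask hn sel).randRisk ((coinData hn sel hβ θ).dist i) p
      = ∑' f, (1 / 2 * (p f).toReal +
          β / 2 * ((p f).toReal * (if θ i = some (sel (code f) i) then 1 else 0))) := by
        refine tsum_congr fun f => ?_
        have := risk_coinData (hn := hn) (sel := sel) hβ θ i f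
        refine (congrArg ((p f).toReal * ·) this).trans ?_
        ring
    _ = _ := by rw [h1.tsum_add h2, tsum_mul_left, tsum_mul_left, tsum_toReal, mul_one, mass]

theorem opt_coinData_le (v : Fin d → Bool) {C : ℝ}
    (h : ∀ i, 1 / 2 + β / 2 * (if θ i = some (sel v i) then 1 else 0) ≤ C) :
    (coinData hn sel hβ θ).opt ≤ C := by
  have hne : Nonempty (Fin (coinTask hn sel).n) := ⟨⟨0, hn⟩⟩
  let f : Predictor (coinTask hn sel).X (coinTask hn sel).Y :=
    ⟨fun _ => (v, (⟨0, hn⟩, fun _ => false)), measurable_const⟩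
  have hf : f ∈ (coinTask hn sel).H := Finset.mem_map_of_mem _ (Finset.mem_univ v)
  refine (Finset.inf'_le _ hf).trans (ciSup_le fun i => ?_)
  exact (risk_coinData hβ θ i f).trans_le (h i)

theorem le_of_isOptimal_coinData {ε C : ℝ}
    {p : PMF (Predictor (coinTask hn sel).X (coinTask hn sel).Y)}
    (hp : (coinData hn sel hβ θ).IsOptimal ε p) (hopt : (coinData hn sel hβ θ).opt ≤ C)
    (i : Fin n) :
    1 / 2 + β / 2 * (mass p fun f => θ i = some (sel (code f) i)) ≤ C + ε := by
  rw [← randRisk_coinData hβ θ i p]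
  have := le_ciSup (Set.finite_range fun i => (coinTask hn sel).randRisk
    ((coinData hn sel hβ θ).dist i) p).bddAbove i
  exact this.trans (hp.trans (by linarith))

theorem integral_log_coinData_le {θ θ' : Fin n → Option K} (i : Fin n)
    (h : θ i = θ' i ∨ θ i = none ∨ θ' i = none) (W : (coinTask hn sel).Z → ℝ)
    (hW : ∀ z, 1 ≤ W z) :
    ∫ z, Real.log (W z) ∂(coinData hn sel hβ θ).dist i ≤
      tiltEntropy β (θ i) (θ' i) + Real.log (∫ z, W z ∂(coinData hn sel hβ θ').dist i) := by
  have hpos : ∀ θ : Option K, ∀ η, 0 < fairWeight K * tilt β θ η := fun θ η =>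
    mul_pos fairWeight_pos (tilt_pos hβ θ η)
  have h1 := sum_mul_log_le (hpos (θ i)) (hpos (θ' i)) (sum_fairWeight_mul_tilt β (θ i))
    fun η => hW (reveal hn sel i η)
  have h2 := sum_tilt_sq_div_le hβ h
  have e1 := integral_coinLaw (hn := hn) (sel := sel) hβ i (θ i) fun z => Real.log (W z)
  have e2 := integral_coinLaw (hn := hn) (sel := sel) hβ i (θ' i) W
  change ∫ z, Real.log (W z) ∂coinLaw hn sel hβ i (θ i) ≤
    _ + Real.log (∫ z, W z ∂coinLaw hn sel hβ i (θ' i))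
  rw [e1, e2]
  linarith

end Risk

end Coins

theorem Learner.cost_const {T : Task} (c : ℝ) (l : List (Fin T.n × T.Z)) :
    Learner.cost (fun _ => c) l = c * l.length := by
  simp [Learner.cost, mul_comm]

theorem toReal_lt_of_lt_ofReal {x : ℝ≥0∞} {B : ℝ} (h : x < ENNReal.ofReal B) : x.toReal < B := by
  have hB : 0 < B := ENNReal.ofReal_pos.1 (bot_le.trans_lt h)
  have := ENNReal.toReal_strict_mono ENNReal.ofReal_ne_top h
  rwa [ENNReal.toReal_ofReal hB.le] at this

/-! ### The term `d`: identifying the favourable hypothesis. -/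

section Identification

variable {n d : ℕ} {ε : ℝ}

theorem abs_six_mul_le (hε : 0 < ε) (hε8 : ε < 1 / 8) : |6 * ε| ≤ 3 / 4 := by
  rw [abs_of_pos (by linarith)]
  linarith

theorem abs_neg_six_mul_le (hε : 0 < ε) (hε8 : ε < 1 / 8) : |-(6 * ε)| ≤ 3 / 4 := by
  rw [abs_neg]
  exact abs_six_mul_le hε hε8

/-- The task with one coin for every hypothesis. -/
abbrev identTask (d : ℕ) (hn : 0 < n) : Task :=
  coinTask (d := d) (K := Fin d → Bool) hn fun v _ => v

/-- Bias `-6ε` puts the optimum at most at `1/2 - 3ε`, while mass `μ` on `v` has risk `1/2 - 3εμ`; a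
slack of `ε` leaves `μ ≥ 2/3`. As `2/3 > 1/2`, no output serves two hypotheses. -/
theorem mass_of_isOptimal_identTask {hn : 0 < n} (hε : 0 < ε) (hε8 : ε < 1 / 8)
    (v : Fin d → Bool) {p : PMF (Predictor (identTask d hn).X (identTask d hn).Y)}
    (hp : (coinData hn (fun v _ => v) (abs_neg_six_mul_le hε hε8) fun _ => some v).IsOptimal ε p) :
    2 / 3 ≤ mass p fun f => some v = some (code f) := by
  have hopt := opt_coinData_le (hn := hn) (sel := fun v _ => v) (abs_neg_six_mul_le hε hε8)
    (fun _ => some v) v (C := 1 / 2 - 3 * ε) fun i => by simp; linarith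
  have := le_of_isOptimal_coinData _ _ hp hopt ⟨0, hn⟩
  by_contra! hlt
  nlinarith

/-- Identifying one of `2 ^ d` hypotheses takes of the order of `d / ε ^ 2` samples. -/
theorem exists_le_expectedSamples_identTask {δ : ℝ} (hn : 0 < n) (hd : 2 ≤ d) (hε : 0 < ε)
    (hε8 : ε < 1 / 8) (hδ : δ < 1 / 8) (A : Learner (identTask d hn))
    (hA : ∀ D, ENNReal.ofReal (1 - δ) ≤ A.law D (A.successEvent D ε)) :
    ∃ D, ENNReal.ofReal (d * Real.log 2 / (128 * ε ^ 2)) ≤ A.expectedSamples D := by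
  by_contra! hB
  set B := d * Real.log 2 / (128 * ε ^ 2) with hBdef
  let D := fun θ : Option (Fin d → Bool) =>
    coinData hn (fun v _ => v) (abs_neg_six_mul_le hε hε8) fun _ => θ
  obtain ⟨t, ht⟩ := A.exists_horizon (fun v => D (some v)) (p := 7 / 8) (by linarith)
    (by norm_num) fun v => hA _
  let E := fun v => A.successSet (D (some v)) ε
  have hE : ∀ v l, MeasurableSet {s | l ∈ E v s} := fun v l =>
    A.measurableSet_mem_successSet _ _ _
  -- With `x = 2^(-d)`, disjointness bounds the average over `v` of the null probability divided by
  -- `x` by `1`, so the middle term of `hstep` averages to at most zero.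
  have hx : (0 : ℝ) < (1 / 2) ^ d := by positivity
  have hlog : Real.log (1 / (1 / 2) ^ d) = d * Real.log 2 := by
    rw [one_div, ← inv_pow, Real.log_pow]
    norm_num
  have hstep : ∀ v, 7 / 8 * (d * Real.log 2) ≤ Real.log 2 +
      ((A.law (D none)).real {a | A.history a.1 a.2 t ∈ E v a.1} / (1 / 2) ^ d - 1) / 2 +
        36 * ε ^ 2 * B := by
    intro v
    have h1 := A.law_real_mul_log_le (D (some v)) (D none) (fun _ => 36 * ε ^ 2)
      (fun i W hW => by
        have := integral_log_coinData_le (hn := hn) (sel := fun v _ => v)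
          (abs_neg_six_mul_le hε hε8) (θ := fun _ => some v) (θ' := fun _ => none) i (by simp) W hW
        simp only [tiltEntropy] at this
        convert this using 2
        ring) t (hE v) hx (pow_le_one₀ (by norm_num) (by norm_num))
    rw [hlog] at h1
    have h2 : ∫ a, Learner.cost (fun _ => 36 * ε ^ 2) (A.history a.1 a.2 t) ∂A.law (D (some v)) ≤
        36 * ε ^ 2 * B := by
      simp only [Learner.cost_const, integral_const_mul]
      have := A.integral_length_le (D (some v)) t (hB _).ne_top
      exact mul_le_mul_of_nonneg_left (this.trans (toReal_lt_of_lt_ofReal (hB _)).le)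
        (by positivity)
    have h3 := mul_le_mul_of_nonneg_right (ht v)
      (show 0 ≤ (d : ℝ) * Real.log 2 by positivity)
    exact (h3.trans h1).trans (by linarith)
  have hdisj : ∑ v, (A.law (D none)).real {a | A.history a.1 a.2 t ∈ E v a.1} ≤ 1 := by
    refine (sum_measureReal_le_measureReal_univ (μ := A.law (D none))
      (fun v _ => A.measurableSet_history_mem t (hE v)) ?_).trans_eq
      probReal_univ
    intro v _ w _ hvw
    refine Set.disjoint_left.2 ?_
    rintro a ⟨_, h1⟩ ⟨_, h2⟩
    have h1 := mass_of_isOptimal_identTask hε hε8 v h1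
    have h2 := mass_of_isOptimal_identTask hε hε8 w h2
    have := mass_add_mass_le_one (A.output a.1 (A.history a.1 a.2 t))
      (fun f => some v = some (code f)) (fun f => some w = some (code f))
      fun f hv hw => hvw (Option.some.inj (hv.trans hw.symm))
    linarith
  have hsum := Finset.sum_le_sum fun v (_ : v ∈ Finset.univ) => hstep v
  simp only [Finset.sum_add_distrib, ← Finset.sum_div, Finset.sum_sub_distrib, Finset.sum_const,
    Finset.card_univ, nsmul_eq_mul, Fintype.card_fun, Fintype.card_bool, Fintype.card_fin] at hsum
  have hM : (0 : ℝ) < 2 ^ d := by positivity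
  have h4 : (∑ v, (A.law (D none)).real {a | A.history a.1 a.2 t ∈ E v a.1}) / (1 / 2) ^ d ≤
      2 ^ d := by
    rw [div_le_iff₀ hx, ← mul_pow]
    simpa using hdisj
  have h5 : 36 * ε ^ 2 * B = 9 / 32 * (d * Real.log 2) := by
    rw [hBdef]
    field_simp
    norm_num
  rw [h5] at hsum
  push_cast at hsum
  have hl2 := Real.log_two_gt_d9
  have hd' : (2 : ℝ) ≤ d := by exact_mod_cast hd
  have h6 : (2 : ℝ) ^ d * (7 / 8 * (d * Real.log 2)) ≤
      2 ^ d * (Real.log 2 + 9 / 32 * (d * Real.log 2)) := by linarith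
  have h7 := le_of_mul_le_mul_left h6 hM
  -- What remains is `(7/8 - 9/32) d ≤ 1`, that is `19 d ≤ 32`, which fails for `d ≥ 2`.
  nlinarith

end Identification

/-! ### Additivity of call costs, and resampling one coordinate of a configuration. -/

section Cost

variable {T : Task}

theorem Learner.cost_sum {ι : Type*} (s : Finset ι) (κ : ι → Fin T.n → ℝ)
    (l : List (Fin T.n × T.Z)) :
    ∑ a ∈ s, Learner.cost (κ a) l = Learner.cost (fun i => ∑ a ∈ s, κ a i) l := by
  induction l with
  | nil => simp [Learner.cost]
  | cons x l ih =>
    simp only [Learner.cost, List.map_cons, List.sum_cons] at ih ⊢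
    rw [Finset.sum_add_distrib, ih]

theorem Learner.cost_mono {κ κ' : Fin T.n → ℝ} (h : ∀ i, κ i ≤ κ' i)
    (l : List (Fin T.n × T.Z)) : Learner.cost κ l ≤ Learner.cost κ' l :=
  List.sum_le_sum fun x _ => h x.1

theorem Learner.cost_const_mul (c : ℝ) (κ : Fin T.n → ℝ) (l : List (Fin T.n × T.Z)) :
    Learner.cost (fun i => c * κ i) l = c * Learner.cost κ l := by
  simp [Learner.cost, List.sum_map_mul_left]

end Cost

/-- Resampling one coordinate preserves the uniform law: exchanging `σ j` with `s` is an involution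
on pairs. It turns bounds for one group into averages over all configurations. -/
theorem sum_sum_update {ι S : Type*} [Fintype ι] [DecidableEq ι] [Fintype S] (j : ι)
    (F : (ι → S) → ℝ) :
    ∑ σ, ∑ s, F (Function.update σ j s) = Fintype.card S * ∑ σ, F σ := by
  have hinv : Function.Involutive fun x : (ι → S) × S => (Function.update x.1 j x.2, x.1 j) := by
    rintro ⟨σ, s⟩
    simp
  have h := Equiv.sum_comp (hinv.toPerm _) fun x : (ι → S) × S => F x.1
  rw [Fintype.sum_prod_type, Fintype.sum_prod_type] at h
  simp only [Finset.sum_const, Finset.card_univ, nsmul_eq_mul, ← Finset.mul_sum] at h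
  exact h

/-! ### The term `n log(k/δ)`: groups of oracles and the sides chosen for them. -/

section Groups

variable {n d k m : ℕ}

/-- The state of a group of `m` oracles: whether one of them is biased, the side to which it is
biased, and its position in the group. -/
abbrev GroupState (m : ℕ) : Type := Bool × Bool × Fin m

/-- The group of an oracle. -/
def groupOf (hk : 0 < k) (i : Fin n) : Fin k := ⟨i % k, Nat.mod_lt _ hk⟩

/-- The oracle at position `r` in group `j`. -/
def oracleAt (hkm : k * m ≤ n) (j : Fin k) (r : Fin m) : Fin n :=
  ⟨j + k * r, by
    calc (j : ℕ) + k * r < k + k * r := by omega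
      _ = k * (r + 1) := by ring
      _ ≤ k * m := Nat.mul_le_mul_left _ (by omega)
      _ ≤ n := hkm⟩

theorem groupOf_oracleAt (hk : 0 < k) (hkm : k * m ≤ n) (j : Fin k) (r : Fin m) :
    groupOf hk (oracleAt hkm j r) = j := by
  ext
  simp [groupOf, oracleAt, Nat.mod_eq_of_lt j.2]

theorem oracleAt_div (hk : 0 < k) (hkm : k * m ≤ n) (j : Fin k) (r : Fin m) :
    (oracleAt hkm j r : ℕ) / k = r := by
  simp [oracleAt, Nat.add_mul_div_left _ _ hk, Nat.div_eq_of_lt j.2]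

theorem eq_oracleAt (hk : 0 < k) (hkm : k * m ≤ n) (i : Fin n) (r : Fin m)
    (h : (i : ℕ) / k = r) : i = oracleAt hkm (groupOf hk i) r := by
  ext
  simp only [oracleAt, groupOf, ← h]
  exact (Nat.mod_add_div _ _).symm

/-- The biased side of an oracle, if it is biased. -/
def oracleState (hk : 0 < k) (σ : Fin k → GroupState m) (i : Fin n) : Option Bool :=
  if (σ (groupOf hk i)).1 = true ∧ (i : ℕ) / k = (σ (groupOf hk i)).2.2 then
    some (σ (groupOf hk i)).2.1
  else none

/-- The side and position kept in an idle state are dummies; they make the uniform law on states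
idle with probability `1/2`. -/
theorem oracleState_update_false (hk : 0 < k) (σ : Fin k → GroupState m) (j : Fin k)
    (x y : Bool × Fin m) :
    oracleState (n := n) hk (Function.update σ j (false, x)) =
      oracleState hk (Function.update σ j (false, y)) := by
  funext i
  rcases eq_or_ne (groupOf hk i) j with h | h
  · simp [oracleState, h]
  · simp [oracleState, h]

/-- Activating an idle group alters a single oracle, so only calls of that oracle count in the
change of measure. -/
theorem oracleState_update (hk : 0 < k) (hkm : k * m ≤ n) (σ : Fin k → GroupState m) (j : Fin k)
    (x : Bool × Fin m) (b : Bool) (r : Fin m) (i : Fin n) (hi : i ≠ oracleAt hkm j r) :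
    oracleState hk (Function.update σ j (false, x)) i =
      oracleState hk (Function.update σ j (true, b, r)) i := by
  rcases eq_or_ne (groupOf hk i) j with h | h
  · have : (i : ℕ) / k ≠ r := fun hr => hi (h ▸ eq_oracleAt hk hkm i r hr)
    simp [oracleState, h, this]
  · simp [oracleState, h]

theorem oracleState_oracleAt (hk : 0 < k) (hkm : k * m ≤ n) (σ : Fin k → GroupState m)
    (j : Fin k) (hj : (σ j).1 = true) :
    oracleState hk σ (oracleAt hkm j (σ j).2.2) = some (σ j).2.1 := by
  rw [oracleState, groupOf_oracleAt, if_pos ⟨hj, oracleAt_div hk hkm _ _⟩]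

theorem oracleState_oracleAt_update_false (hk : 0 < k) (hkm : k * m ≤ n)
    (σ : Fin k → GroupState m) (j : Fin k) (x : Bool × Fin m) (r : Fin m) :
    oracleState hk (Function.update σ j (false, x)) (oracleAt hkm j r) = none := by
  simp [oracleState, groupOf_oracleAt]

/-- A hypothesis picks a side for every group. -/
def sideOf (hk : 0 < k) (hkd : k ≤ d) (v : Fin d → Bool) (i : Fin n) : Bool :=
  v (Fin.castLE hkd (groupOf hk i))

/-- The task in which the hypotheses pick a side for every group of oracles. -/
abbrev groupTask (hn : 0 < n) (hk : 0 < k) (hkd : k ≤ d) : Task :=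
  coinTask hn (sideOf (n := n) hk hkd)

variable {ε : ℝ} (hn : 0 < n) (hk : 0 < k) (hkd : k ≤ d) (hkm : k * m ≤ n) (hε : 0 < ε)
  (hε8 : ε < 1 / 8)

/-- The problem in which the groups have the states `σ`. -/
def groupData (σ : Fin k → GroupState m) : DataDistributions (groupTask hn hk hkd) :=
  coinData hn (sideOf hk hkd) (abs_six_mul_le hε hε8) (oracleState hk σ)

/-- The probability that a randomized predictor picks side `b` for group `j`. -/
def sideMass (p : PMF (Predictor (groupTask (n := n) hn hk hkd).X (groupTask hn hk hkd).Y))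
    (j : Fin k) (b : Bool) : ℝ :=
  mass p fun f => code f (Fin.castLE hkd j) = b

theorem one_le_sideMass_add
    (p : PMF (Predictor (groupTask (n := n) hn hk hkd).X (groupTask hn hk hkd).Y)) (j : Fin k) :
    1 ≤ sideMass hn hk hkd p j false + sideMass hn hk hkd p j true :=
  one_le_mass_add_mass p _ _ fun f => by
    cases code f (Fin.castLE hkd j) <;> simp

-- A learner guarantees measurability only for the risks of its output; the mass on a side is an
-- affine function of the risk under an auxiliary problem of bias `1/2`.
include hkm in
theorem measurable_sideMass (hm : 0 < m) (A : Learner (groupTask (n := n) hn hk hkd))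
    (l : List (Fin n × (groupTask (n := n) hn hk hkd).Z)) (j : Fin k) (b : Bool) :
    Measurable fun s => sideMass hn hk hkd (A.output s l) j b := by
  have hβ : |(1 / 2 : ℝ)| ≤ 3 / 4 := by norm_num [abs_of_pos]
  let i := oracleAt hkm j ⟨0, hm⟩
  let D := coinData hn (sideOf (n := n) hk hkd) hβ fun _ => some b
  have := D.isProb i
  have h := A.measurable_randRisk_output l (D.dist i)
  have e : (fun s => sideMass hn hk hkd (A.output s l) j b) = fun s =>
      4 * (Task.randRisk (groupTask hn hk hkd) (D.dist i) (A.output s l) - 1 / 2) := by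
    funext s
    have h1 := randRisk_coinData (hn := hn) (sel := sideOf hk hkd) hβ (fun _ => some b) i
      (A.output s l)
    have h2 : sideMass hn hk hkd (A.output s l) j b = mass (A.output s l)
        fun f => some b = some (sideOf hk hkd (code f) i) := by
      unfold sideMass mass
      refine tsum_congr fun f => ?_
      simp only [sideOf, i, groupOf_oracleAt, Option.some.injEq]
      congr 1
      exact if_congr eq_comm rfl rfl
    rw [h2]
    linear_combination (-4) * h1
  rw [e]
  exact (h.sub_const _).const_mul _

-- Avoiding every biased side gives `OPT ≤ 1/2`, while mass `μ` on a biased side costs `1/2 + 3εμ`;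
-- hence `μ ≤ 1/3`.
include hkm in
theorem sideMass_lt_of_isOptimal (σ : Fin k → GroupState m)
    {p : PMF (Predictor (groupTask (n := n) hn hk hkd).X (groupTask hn hk hkd).Y)}
    (hp : (groupData hn hk hkd hε hε8 σ).IsOptimal ε p) (j : Fin k) (hj : (σ j).1 = true) :
    sideMass hn hk hkd p j (σ j).2.1 < 1 / 2 := by
  let v : Fin d → Bool := fun x => if hx : (x : ℕ) < k then !(σ ⟨x, hx⟩).2.1 else false
  have hv : ∀ i : Fin n, oracleState hk σ i ≠ some (sideOf hk hkd v i) := by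
    intro i
    have : sideOf hk hkd v i = !(σ (groupOf hk i)).2.1 := by
      simp [sideOf, v]
    rw [this, oracleState]
    split_ifs <;> simp
  have hopt := opt_coinData_le (hn := hn) (sel := sideOf hk hkd) (abs_six_mul_le hε hε8)
    (oracleState hk σ) v (C := 1 / 2) fun i => by simp [hv i]
  have h := le_of_isOptimal_coinData _ _ hp hopt (oracleAt hkm j (σ j).2.2)
  have h2 : sideMass hn hk hkd p j (σ j).2.1 = mass p fun f =>
      oracleState hk σ (oracleAt hkm j (σ j).2.2) =
        some (sideOf hk hkd (code f) (oracleAt hkm j (σ j).2.2)) := by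
    unfold sideMass mass
    refine tsum_congr fun f => ?_
    simp only [sideOf, oracleState_oracleAt hk hkm σ j hj, groupOf_oracleAt, Option.some.injEq]
    congr 1
    exact if_congr eq_comm rfl rfl
  rw [← h2] at h
  by_contra! hge
  nlinarith

variable (A : Learner (groupTask (n := n) hn hk hkd))

/-- The histories at which the learner stops and picks side `b` for group `j`, while for no biased
group before `j` it picks the side of the bias. -/
def pickSet (σ : Fin k → GroupState m) (j : Fin k) (b : Bool) (s : A.Seed) :
    Set (List (Fin n × (groupTask (n := n) hn hk hkd).Z)) :=
  {l | A.query s l = none ∧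
    (∀ j' < j, (σ j').1 = true → sideMass hn hk hkd (A.output s l) j' (σ j').2.1 < 1 / 2) ∧
    1 / 2 ≤ sideMass hn hk hkd (A.output s l) j b}

include hkm in
theorem measurableSet_mem_pickSet (hm : 0 < m) (σ : Fin k → GroupState m) (j : Fin k) (b : Bool)
    (l : List (Fin n × (groupTask (n := n) hn hk hkd).Z)) :
    MeasurableSet {s | l ∈ pickSet hn hk hkd A σ j b s} := by
  have hms := fun j b => measurable_sideMass hn hk hkd hkm hm A l j b
  have h : MeasurableSet {s | ∀ j' < j, (σ j').1 = true →
      sideMass hn hk hkd (A.output s l) j' (σ j').2.1 < 1 / 2} := by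
    simp only [Set.ofPred_forall]
    exact .iInter fun j' => .iInter fun _ => .iInter fun _ =>
      measurableSet_lt (hms _ _) measurable_const
  exact (A.measurable_query l none).inter (h.inter (measurableSet_le measurable_const (hms j b)))

/-- The event ignores the state of group `j` itself, so it can be compared between the idle and the
biased versions of that group. -/
theorem pickSet_update (σ : Fin k → GroupState m) (j : Fin k) (b : Bool) (x : GroupState m) :
    pickSet hn hk hkd A (Function.update σ j x) j b = pickSet hn hk hkd A σ j b := by
  funext s
  ext l
  refine and_congr Iff.rfl (and_congr (forall₂_congr fun j' hj' => ?_) Iff.rfl)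
  rw [Function.update_of_ne hj'.ne]

end Groups

/-! ### Error and sampling cost of a single group. -/

section GroupBound

variable {n d k m : ℕ} {ε : ℝ} (hn : 0 < n) (hk : 0 < k) (hkd : k ≤ d) (hkm : k * m ≤ n)
  (hε : 0 < ε) (hε8 : ε < 1 / 8) (A : Learner (groupTask (n := n) hn hk hkd)) (t : ℕ)

/-- The probability that `j` is the first biased group for which the learner errs. -/
def failProb (σ : Fin k → GroupState m) (j : Fin k) : ℝ :=
  if (σ j).1 = true then (A.law (groupData hn hk hkd hε hε8 σ)).real
    {a | A.history a.1 a.2 t ∈ pickSet hn hk hkd A σ j (σ j).2.1 a.1}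
  else 0

/-- The expected number of calls of the oracles of group `j`, when it is unbiased. -/
def idleCost (σ : Fin k → GroupState m) (j : Fin k) : ℝ :=
  if (σ j).1 = true then 0 else
    ∫ a, Learner.cost (T := groupTask hn hk hkd) (fun i => if groupOf hk i = j then 1 else 0)
      (A.history a.1 a.2 t) ∂A.law (groupData hn hk hkd hε hε8 σ)

theorem failProb_nonneg (σ : Fin k → GroupState m) (j : Fin k) :
    0 ≤ failProb hn hk hkd hε hε8 A t σ j := by
  unfold failProb
  split_ifs
  · exact measureReal_nonneg
  · exact le_rfl

-- Each event forces a failure, and they are disjoint because each asks for no error in the earlier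
-- biased groups. The groups therefore share one `δ`.
include hkm in
theorem sum_failProb_le {δ : ℝ} (hm : 0 < m)
    (hA : ∀ D, ENNReal.ofReal (1 - δ) ≤ A.law D (A.successEvent D ε))
    (σ : Fin k → GroupState m) : ∑ j, failProb hn hk hkd hε hε8 A t σ j ≤ δ := by
  classical
  set D := groupData hn hk hkd hε hε8 σ with hD
  let E : Fin k → A.Seed → Set (List (Fin n × (groupTask (n := n) hn hk hkd).Z)) := fun j s =>
    {l | (σ j).1 = true ∧ l ∈ pickSet hn hk hkd A σ j (σ j).2.1 s}
  have hE : ∀ j l, MeasurableSet {s | l ∈ E j s} := fun j l =>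
    (MeasurableSet.const _).inter (measurableSet_mem_pickSet hn hk hkd hkm A hm σ j _ l)
  have hfail : ∀ j, failProb hn hk hkd hε hε8 A t σ j =
      (A.law D).real {a | A.history a.1 a.2 t ∈ E j a.1} := by
    intro j
    unfold failProb
    split_ifs with hj
    · simp [E, hj, hD]
    · have : {a : A.Seed × (ℕ → Fin n → (groupTask (n := n) hn hk hkd).Z) |
          A.history a.1 a.2 t ∈ E j a.1} = ∅ := by
        refine Set.eq_empty_of_forall_notMem fun a ha => hj ha.1
      exact (congrArg (A.law D).real this |>.trans measureReal_empty).symm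
  have h1 := A.law_real_le_of_disjoint D (hA D) t (E := fun s => {l | ∃ j, l ∈ E j s})
    (fun l => by
      have : {s | ∃ j, l ∈ E j s} = ⋃ j, {s | l ∈ E j s} := by ext; simp
      change MeasurableSet {s | ∃ j, l ∈ E j s}
      rw [this]
      exact .iUnion fun j => hE j l)
    (by
      rintro s l ⟨j, hj, hq, _, hge⟩
      refine ⟨hq, fun hopt => ?_⟩
      exact absurd (sideMass_lt_of_isOptimal hn hk hkd hkm hε hε8 σ hopt j hj) (not_lt.2 hge))
  refine le_trans ?_ h1
  simp only [hfail]
  have h2 : {a : A.Seed × (ℕ → Fin n → (groupTask (n := n) hn hk hkd).Z) |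
      A.history a.1 a.2 t ∈ {l | ∃ j, l ∈ E j a.1}} =
      ⋃ j ∈ Finset.univ, {a | A.history a.1 a.2 t ∈ E j a.1} := by
    ext a
    simp only [Set.mem_iUnion, Finset.mem_univ, exists_const]
    rfl
  refine le_of_eq (Eq.trans ?_ (congrArg (A.law D).real h2).symm)
  refine (measureReal_biUnion_finset ?_ fun j _ => A.measurableSet_history_mem t (hE j)).symm
  intro i _ j _ hij
  refine Set.disjoint_left.2 ?_
  rintro a ⟨hi, _, hlti, hgei⟩ ⟨hj, _, hltj, hgej⟩
  rcases lt_or_gt_of_ne hij with h | h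
  · exact absurd (hltj i h hi) (not_lt.2 hgei)
  · exact absurd (hlti j h hj) (not_lt.2 hgej)

theorem sum_idleCost_le {B : ℝ} (σ : Fin k → GroupState m)
    (hB : A.expectedSamples (groupData hn hk hkd hε hε8 σ) < ENNReal.ofReal B) :
    ∑ j, idleCost hn hk hkd hε hε8 A t σ j ≤ B := by
  set D := groupData hn hk hkd hε hε8 σ with hD
  let κ : Fin k → Fin n → ℝ := fun j i => if groupOf hk i = j then 1 else 0
  have hle : ∀ j, idleCost hn hk hkd hε hε8 A t σ j ≤
      ∫ a, Learner.cost (T := groupTask hn hk hkd) (κ j) (A.history a.1 a.2 t) ∂A.law D := by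
    intro j
    unfold idleCost
    split_ifs
    · refine integral_nonneg fun a => List.sum_nonneg ?_
      intro x hx
      obtain ⟨y, _, rfl⟩ := List.mem_map.1 hx
      change 0 ≤ κ j y.1
      simp only [κ]
      split_ifs <;> norm_num
    · exact le_rfl
  refine (Finset.sum_le_sum fun j _ => hle j).trans ?_
  rw [← integral_finsetSum _ fun j _ => A.integrable_cost D (κ j) t]
  have hsum : ∀ i, ∑ j, κ j i = 1 := fun i => by simp [κ]
  have hlen : ∀ a : A.Seed × (ℕ → Fin n → (groupTask (n := n) hn hk hkd).Z),
      ∑ j, Learner.cost (T := groupTask hn hk hkd) (κ j) (A.history a.1 a.2 t) =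
        (A.history a.1 a.2 t).length := fun a => by
    refine (Learner.cost_sum (T := groupTask hn hk hkd) Finset.univ κ _).trans ?_
    refine (congrArg (fun κ => Learner.cost (T := groupTask hn hk hkd) κ (A.history a.1 a.2 t))
      (funext hsum)).trans ?_
    rw [Learner.cost_const, one_mul]
  refine (integral_congr_ae (.of_forall hlen)).trans_le ?_
  exact (A.integral_length_le D t hB.ne_top).trans (toReal_lt_of_lt_ofReal hB).le

include hkm in
/-- The cost of one group, with the states of the other groups fixed. -/
theorem group_cost (hm : 0 < m) (σ : Fin k → GroupState m) (j : Fin k)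
    (ht : ∀ σ : Fin k → GroupState m, 7 / 8 ≤ (A.law (groupData hn hk hkd hε hε8 σ)).real
      {a | A.history a.1 a.2 t ∈ A.successSet (groupData hn hk hkd hε hε8 σ) ε a.1})
    {x : ℝ} (hx : 0 < x) (hx1 : x ≤ 1) :
    m * (7 / 8 * Real.log (1 / x)) ≤ 2 * m * (Real.log 2 - 1 / 2) +
      (∑ s, failProb hn hk hkd hε hε8 A t (Function.update σ j s) j) / (2 * x) +
      144 * ε ^ 2 / m * ∑ s, idleCost hn hk hkd hε hε8 A t (Function.update σ j s) j := by
  let D := groupData (m := m) hn hk hkd hε hε8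
  let σ₀ := Function.update σ j (false, false, ⟨0, hm⟩)
  let κ : Fin n → ℝ := fun i => if groupOf hk i = j then 1 else 0
  let P := fun b => (A.law (D σ₀)).real
    {a | A.history a.1 a.2 t ∈ pickSet hn hk hkd A σ j b a.1}
  let Q := fun b r => (A.law (D (Function.update σ j (true, b, r)))).real
    {a | A.history a.1 a.2 t ∈ pickSet hn hk hkd A σ j b a.1}
  let χ : Fin m → Fin n → ℝ := fun r i => if i = oracleAt hkm j r then 1 else 0
  let C := fun r => ∫ a, Learner.cost (T := groupTask hn hk hkd) (χ r) (A.history a.1 a.2 t) ∂A.law (D σ₀)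
  let C₀ := ∫ a, Learner.cost (T := groupTask hn hk hkd) κ (A.history a.1 a.2 t) ∂A.law (D σ₀)
  have hE := measurableSet_mem_pickSet hn hk hkd hkm A hm σ j
  have hm' : (0 : ℝ) < m := by exact_mod_cast hm
  have hL : 0 ≤ Real.log (1 / x) := Real.log_nonneg (by rw [le_div_iff₀ hx]; linarith)
  -- Idle against biased at position `r` towards `b`: the event that is harmless in the first
  -- problem is an error in the second. The constant is `4 β^2` at `β = 6ε`.
  have hlocal : ∀ b r, P b * Real.log (1 / x) ≤
      Real.log 2 + (Q b r / x - 1) / 2 + 144 * ε ^ 2 * C r := by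
    intro b r
    have h := A.law_real_mul_log_le (D σ₀) (D (Function.update σ j (true, b, r)))
      (fun i => 144 * ε ^ 2 * χ r i) (fun i W hW => by
        change Fin n at i
        have h0 : oracleState hk σ₀ i = oracleState hk (Function.update σ j (true, b, r)) i ∨
            oracleState hk σ₀ i = none := by
          by_cases hi : i = oracleAt hkm j r
          · exact .inr (hi ▸ oracleState_oracleAt_update_false hk hkm σ j _ r)
          · exact .inl (oracleState_update hk hkm σ j _ b r i hi)
        refine (integral_log_coinData_le (hn := hn) (sel := sideOf hk hkd)
          (abs_six_mul_le hε hε8) i (h0.imp id .inl) W hW).trans (add_le_add_left ?_ _)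
        by_cases hi : i = oracleAt hkm j r
        · have h1 : oracleState hk σ₀ i = none :=
            hi ▸ oracleState_oracleAt_update_false hk hkm σ j _ r
          rw [h1, show χ r i = 1 from if_pos hi]
          cases oracleState hk (Function.update σ j (true, b, r)) i
          · simp only [tiltEntropy]
            positivity
          · simp only [tiltEntropy]
            linarith
        · have h1 : oracleState hk σ₀ i = _ := oracleState_update hk hkm σ j _ b r i hi
          rw [h1, show χ r i = 0 from if_neg hi]
          cases oracleState hk (Function.update σ j (true, b, r)) i <;> simp [tiltEntropy])
      t (hE b) hx hx1
    refine h.trans_eq ?_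
    have hc : ∀ a : A.Seed × (ℕ → Fin n → (groupTask (n := n) hn hk hkd).Z),
        Learner.cost (T := groupTask hn hk hkd)
          (fun i => 144 * ε ^ 2 * χ r i)
          (A.history a.1 a.2 t) = 144 * ε ^ 2 * Learner.cost (T := groupTask hn hk hkd)
          (χ r) (A.history a.1 a.2 t) :=
      fun a => Learner.cost_const_mul _ _ _
    refine congrArg₂ (· + ·) rfl ?_
    exact (integral_congr_ae (.of_forall hc)).trans (integral_const_mul _ _)
  -- On success all earlier biased groups are handled correctly, and some side of group `j` has mass
  -- at least `1/2`.
  have hP : 7 / 8 ≤ P false + P true := by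
    refine (ht σ₀).trans (le_trans (measureReal_mono ?_ (measure_ne_top _ _))
      (measureReal_union_le _ _))
    rintro a ⟨hq, hopt⟩
    have hlt : ∀ j' < j, (σ j').1 = true →
        sideMass hn hk hkd (A.output a.1 (A.history a.1 a.2 t)) j' (σ j').2.1 < 1 / 2 := by
      intro j' hj' hact
      have hσ : σ₀ j' = σ j' := Function.update_of_ne hj'.ne _ _
      have := sideMass_lt_of_isOptimal hn hk hkd hkm hε hε8 σ₀ hopt j' (hσ ▸ hact)
      rwa [hσ] at this
    have h1 := one_le_sideMass_add hn hk hkd (A.output a.1 (A.history a.1 a.2 t)) j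
    by_cases hf : 1 / 2 ≤ sideMass hn hk hkd (A.output a.1 (A.history a.1 a.2 t)) j false
    · exact .inl ⟨hq, hlt, hf⟩
    · exact .inr ⟨hq, hlt, by linarith⟩
  -- Only an inequality, since leftover oracles belong to a group but have no position in it.
  have hC : ∑ r, C r ≤ C₀ := by
    refine (integral_finsetSum _ fun r _ => A.integrable_cost (D σ₀) (χ r) t).symm.trans_le ?_
    refine integral_mono (integrable_finsetSum _ fun r _ => A.integrable_cost _ _ t)
      (A.integrable_cost _ _ t) fun a => ?_
    refine (Learner.cost_sum (T := groupTask hn hk hkd) Finset.univ _ _).trans_le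
      (Learner.cost_mono (fun i => ?_) _)
    change Fin n at i
    change ∑ r : Fin m, (if i = oracleAt hkm j r then 1 else 0 : ℝ) ≤
      if groupOf hk i = j then 1 else 0
    by_cases hi : ∃ r, i = oracleAt hkm j r
    · obtain ⟨r, rfl⟩ := hi
      rw [groupOf_oracleAt, if_pos rfl, Finset.sum_eq_single r]
      · simp
      · intro r' _ hr'
        refine if_neg fun h => hr' ?_
        have := congrArg (fun i : Fin n => (i : ℕ) / k) h
        simp only [oracleAt_div hk hkm] at this
        exact (Fin.ext this).symm
      · simp
    · push Not at hi
      rw [Finset.sum_eq_zero fun r _ => if_neg (hi r)]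
      split_ifs <;> norm_num
  have hF : ∑ s, failProb hn hk hkd hε hε8 A t (Function.update σ j s) j =
      ∑ b, ∑ r, Q b r := by
    rw [Fintype.sum_prod_type, Fintype.sum_bool]
    simp only [failProb, Function.update_self, if_true, Bool.false_eq_true, if_false,
      Finset.sum_const_zero, add_zero, Fintype.sum_prod_type, pickSet_update]
    rfl
  -- All `2m` idle states define the same problem.
  have hG : ∑ s, idleCost hn hk hkd hε hε8 A t (Function.update σ j s) j = 2 * m * C₀ := by
    rw [Fintype.sum_prod_type, Fintype.sum_bool]
    have hD : ∀ y, groupData hn hk hkd hε hε8 (Function.update σ j (false, y)) = D σ₀ := by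
      intro y
      simp only [D, groupData, σ₀]
      rw [oracleState_update_false hk σ j y (false, ⟨0, hm⟩)]
    simp only [idleCost, Function.update_self, if_true, Bool.false_eq_true, if_false,
      Finset.sum_const_zero, zero_add, hD]
    rw [Finset.sum_const, Finset.card_univ, nsmul_eq_mul, Fintype.card_prod, Fintype.card_bool,
      Fintype.card_fin]
    push_cast
    rfl
  have hsum := Finset.sum_le_sum fun b (_ : b ∈ Finset.univ) =>
    Finset.sum_le_sum fun r (_ : r ∈ Finset.univ) => hlocal b r
  simp only [Finset.sum_add_distrib, ← Finset.sum_div, Finset.sum_sub_distrib, Finset.sum_const,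
    Finset.card_univ, nsmul_eq_mul, Fintype.card_bool, Fintype.card_fin, ← Finset.mul_sum,
    Fintype.sum_bool, mul_one] at hsum
  rw [hF, hG, Fintype.sum_bool]
  have h1 : m * (7 / 8 * Real.log (1 / x)) ≤ m * (P true * Real.log (1 / x)) +
      m * (P false * Real.log (1 / x)) := by
    rw [← mul_add, ← add_mul]
    refine mul_le_mul_of_nonneg_left (mul_le_mul_of_nonneg_right ?_ hL) hm'.le
    linarith
  have h2 : 144 * ε ^ 2 / m * (2 * m * C₀) = 2 * (144 * ε ^ 2 * C₀) := by
    field_simp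
  have h3 := mul_le_mul_of_nonneg_left hC (show 0 ≤ 144 * ε ^ 2 by positivity)
  have h4 : (∑ r, Q true r + ∑ r, Q false r) / (2 * x) =
      (∑ r, Q true r + ∑ r, Q false r) / x / 2 := by
    field_simp
  rw [h2, h4]
  push_cast at hsum
  linarith

end GroupBound

/-! ### Averaging over groups and configurations. -/

section GroupTotal

variable {n d k m : ℕ} {ε : ℝ} (hn : 0 < n) (hk : 0 < k) (hkd : k ≤ d) (hkm : k * m ≤ n)
  (hε : 0 < ε) (hε8 : ε < 1 / 8) (A : Learner (groupTask (n := n) hn hk hkd)) (t : ℕ)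

-- The factor `1/2` appears because an idle group, half of the configurations, has no error.
include hkm in
theorem sum_failProb_config_le {δ : ℝ} (hm : 0 < m)
    (hA : ∀ D, ENNReal.ofReal (1 - δ) ≤ A.law D (A.successEvent D ε)) (j : Fin k) :
    ∑ σ : Fin k → GroupState m, failProb hn hk hkd hε hε8 A t σ j ≤
      Fintype.card (Fin k → GroupState m) * (δ / 2) := by
  have hle : ∀ σ : Fin k → GroupState m, failProb hn hk hkd hε hε8 A t σ j ≤ δ := fun σ =>
    (Finset.single_le_sum (fun j _ => failProb_nonneg hn hk hkd hε hε8 A t σ j)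
      (Finset.mem_univ j)).trans (sum_failProb_le hn hk hkd hkm hε hε8 A t hm hA σ)
  have hσ : ∀ σ : Fin k → GroupState m,
      ∑ s, failProb hn hk hkd hε hε8 A t (Function.update σ j s) j ≤ 2 * m * δ := by
    intro σ
    rw [Fintype.sum_prod_type, Fintype.sum_bool]
    have h0 : ∀ y, failProb hn hk hkd hε hε8 A t (Function.update σ j (false, y)) j = 0 :=
      fun y => by simp [failProb]
    simp only [h0, Finset.sum_const_zero, add_zero]
    refine (Finset.sum_le_sum fun y _ => hle _).trans_eq ?_
    simp
  have h := sum_sum_update j fun σ : Fin k → GroupState m =>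
    failProb hn hk hkd hε hε8 A t σ j
  have h2 := Finset.sum_le_sum fun σ (_ : σ ∈ Finset.univ) => hσ σ
  rw [h, Finset.sum_const, Finset.card_univ, nsmul_eq_mul] at h2
  have hm' : (0 : ℝ) < m := by exact_mod_cast hm
  have hS : (Fintype.card (GroupState m) : ℝ) = 4 * m := by
    simp [Fintype.card_prod]
    ring
  rw [hS] at h2
  refine le_of_mul_le_mul_left (h2.trans_eq ?_) (show (0 : ℝ) < 4 * m by positivity)
  ring

/-- The cap `1/8` makes the logarithm dominate the additive `log 2` terms. The factor `2/3` absorbs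
a loss of `log 2`, as `k / δ ≥ 8`. -/
theorem log_threshold {δ : ℝ} (hk : 0 < k) (hδ : 0 < δ) (hδ8 : δ < 1 / 8) :
    Real.log (1 / min (2 * δ / k) (1 / 8)) ≥ 3 * Real.log 2 ∧
      Real.log (1 / min (2 * δ / k) (1 / 8)) ≥ 2 / 3 * Real.log (k / δ) := by
  have hk' : (1 : ℝ) ≤ k := by exact_mod_cast hk
  have hx : 0 < min (2 * δ / k) (1 / 8) := by positivity
  have h8 : Real.log 8 = 3 * Real.log 2 := by
    rw [show (8 : ℝ) = 2 ^ 3 by norm_num, Real.log_pow]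
    norm_num
  constructor
  · rw [← h8]
    refine Real.log_le_log (by norm_num) ?_
    rw [le_div_iff₀ hx]
    linarith [min_le_right (2 * δ / k) (1 / 8)]
  · have h1 : Real.log ((k / δ) / 2) ≤ Real.log (1 / min (2 * δ / k) (1 / 8)) := by
      refine Real.log_le_log (by positivity) ?_
      rw [le_div_iff₀ hx]
      refine (mul_le_mul_of_nonneg_left (min_le_left _ _) (by positivity)).trans_eq ?_
      field_simp
    have h2 : Real.log 8 ≤ Real.log (k / δ) := by
      refine Real.log_le_log (by norm_num) ?_
      rw [le_div_iff₀ hδ]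
      linarith
    rw [Real.log_div (by positivity) (by norm_num)] at h1
    linarith

include hkm in
/-- Deciding on a side for every group takes of the order of `k * m * log (k / δ) / ε ^ 2`
samples. -/
theorem exists_le_expectedSamples_groupTask {δ : ℝ} (hm : 0 < m) (hε : 0 < ε) (hε8 : ε < 1 / 8)
    (hδ : 0 < δ) (hδ8 : δ < 1 / 8)
    (hA : ∀ D, ENNReal.ofReal (1 - δ) ≤ A.law D (A.successEvent D ε)) :
    ∃ D, ENNReal.ofReal (k * m * Real.log (k / δ) / (4608 * ε ^ 2)) ≤ A.expectedSamples D := by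
  by_contra! hB
  set B := k * m * Real.log (k / δ) / (4608 * ε ^ 2) with hBdef
  obtain ⟨t, ht⟩ := A.exists_horizon (groupData (m := m) hn hk hkd hε hε8) (p := 7 / 8)
    (by linarith) (by norm_num) fun σ => hA _
  have hk1 : (1 : ℝ) ≤ k := by exact_mod_cast hk
  have hm' : (0 : ℝ) < m := by exact_mod_cast hm
  set x := min (2 * δ / k) (1 / 8) with hxdef
  have hx : 0 < x := by positivity
  have hx8 : x ≤ 1 / 8 := min_le_right _ _
  obtain ⟨hL2, hLk⟩ := log_threshold hk hδ hδ8
  rw [← hxdef] at hL2 hLk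
  have : Nonempty (Fin m) := ⟨⟨0, hm⟩⟩
  set M : ℝ := ((Fintype.card (Fin k → GroupState m) : ℕ) : ℝ) with hM
  have hM0 : 0 < M := Nat.cast_pos.2 Fintype.card_pos
  set F := ∑ j, ∑ σ : Fin k → GroupState m, failProb hn hk hkd hε hε8 A t σ j with hF
  set G := ∑ j, ∑ σ : Fin k → GroupState m, idleCost hn hk hkd hε hε8 A t σ j with hG
  -- If `x = 2δ/k`, sharing `δ` among the groups suffices. If the cap `x = 1/8` is active, the bound
  -- `δ/2 ≤ 1/16` per group is used instead.
  have hFx : F ≤ k * M * (x / 2) := by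
    rcases min_choice (2 * δ / k) (1 / 8) with h | h
    · have h1 : F ≤ M * δ := by
        rw [hF, Finset.sum_comm]
        refine (Finset.sum_le_sum fun σ _ =>
          sum_failProb_le hn hk hkd hkm hε hε8 A t hm hA σ).trans_eq ?_
        rw [Finset.sum_const, Finset.card_univ, nsmul_eq_mul]
      refine h1.trans_eq ?_
      rw [hxdef, h]
      field_simp
    · have h1 : F ≤ k * (M * (δ / 2)) := by
        refine (Finset.sum_le_sum fun j _ =>
          sum_failProb_config_le hn hk hkd hkm hε hε8 A t hm hA j).trans_eq ?_
        rw [Finset.sum_const, Finset.card_univ, nsmul_eq_mul, Fintype.card_fin]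
      refine h1.trans ?_
      rw [← mul_assoc]
      refine mul_le_mul_of_nonneg_left ?_ (by positivity)
      rw [hxdef, h]
      linarith
  have hGB : G ≤ M * B := by
    rw [hG, Finset.sum_comm]
    refine (Finset.sum_le_sum fun σ _ =>
      sum_idleCost_le hn hk hkd hε hε8 A t σ (hB _)).trans_eq ?_
    rw [Finset.sum_const, Finset.card_univ, nsmul_eq_mul]
  have hsum := Finset.sum_le_sum fun j (_ : j ∈ (Finset.univ : Finset (Fin k))) =>
    Finset.sum_le_sum fun σ (_ : σ ∈ (Finset.univ : Finset (Fin k → GroupState m))) =>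
      group_cost hn hk hkd hkm hε hε8 A t hm σ j ht hx (hx8.trans (by norm_num))
  have hS : (Fintype.card (GroupState m) : ℝ) = 4 * m := by
    simp [Fintype.card_prod]
    ring
  have hFu : ∀ j, ∑ σ : Fin k → GroupState m,
      ∑ s, failProb hn hk hkd hε hε8 A t (Function.update σ j s) j =
      4 * m * ∑ σ : Fin k → GroupState m, failProb hn hk hkd hε hε8 A t σ j := fun j => by
    rw [← hS]
    exact sum_sum_update j fun σ => failProb hn hk hkd hε hε8 A t σ j
  have hGu : ∀ j, ∑ σ : Fin k → GroupState m,
      ∑ s, idleCost hn hk hkd hε hε8 A t (Function.update σ j s) j =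
      4 * m * ∑ σ : Fin k → GroupState m, idleCost hn hk hkd hε hε8 A t σ j := fun j => by
    rw [← hS]
    exact sum_sum_update j fun σ => idleCost hn hk hkd hε hε8 A t σ j
  simp only [Finset.sum_add_distrib, ← Finset.sum_div, ← Finset.mul_sum, hFu, hGu,
    Finset.sum_const, Finset.card_univ, nsmul_eq_mul] at hsum
  rw [← hM, ← hF, ← hG, Fintype.card_fin] at hsum
  -- The choice of `x` makes this cancel the `-1/2` in `2 m (log 2 - 1/2)`.
  have h1 : 4 * m * F / (2 * x) ≤ k * M * m := by
    rw [div_le_iff₀ (by positivity)]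
    have := mul_le_mul_of_nonneg_left hFx (show (0 : ℝ) ≤ 4 * m by positivity)
    linarith
  have h2 : 144 * ε ^ 2 / m * (4 * m * G) ≤ 576 * ε ^ 2 * (M * B) := by
    have : 144 * ε ^ 2 / m * (4 * m * G) = 576 * ε ^ 2 * G := by
      field_simp
      ring
    rw [this]
    exact mul_le_mul_of_nonneg_left hGB (by positivity)
  have h3 : 576 * ε ^ 2 * (M * B) = M * (k * m) * (Real.log (k / δ) / 8) := by
    rw [hBdef]
    field_simp
    ring
  rw [h3] at h2
  have hpos : 0 < M * (k * m) := by positivity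
  have h4 : M * (k * m) * (7 / 8 * Real.log (1 / x)) ≤
      M * (k * m) * (2 * Real.log 2 + Real.log (k / δ) / 8) := by
    linarith
  have h5 := le_of_mul_le_mul_left h4 hpos
  have hl2 := Real.log_two_gt_d9
  -- With `L = log (1/x)`, the right side of `h4` is at most `(2/3 + 3/16) L = (41/48) L`, below
  -- `(7/8) L`.
  linarith

end GroupTotal

end CollabLearning

end

/-! ### Combination of the two bounds. -/

theorem mainTheorem2 :
    ∃ c : ℝ, 0 < c ∧
      ∀ (n d : ℕ), 1 ≤ n → 1 ≤ d →
      ∀ (ε δ : ℝ), 0 < ε → ε < 1 / 8 → 0 < δ → δ < 1 / 8 →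
      ∀ Q : CollabLearning.Algorithm, CollabLearning.IsCollaborativeLearner Q ε δ →
        ∃ (T : CollabLearning.Task) (D : CollabLearning.DataDistributions T),
          T.n = n ∧ T.H.card = 2 ^ d ∧
          ENNReal.ofReal
              (c * (1 / ε ^ 2 * ((d : ℝ) + (n : ℝ) * Real.log (((min n d : ℕ) : ℝ) / δ))))
            ≤ (Q T).expectedSamples D ∧
          (n ≤ d →
            ENNReal.ofReal (c * (1 / ε ^ 2 * ((d : ℝ) + (n : ℝ) * Real.log ((n : ℝ) / δ))))
              ≤ (Q T).expectedSamples D) := by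
  refine ⟨1 / 20000, by norm_num, fun n d hn hd ε δ hε hε8 hδ hδ8 Q hQ => ?_⟩
  suffices h : ∃ (T : CollabLearning.Task) (D : CollabLearning.DataDistributions T),
      T.n = n ∧ T.H.card = 2 ^ d ∧ ENNReal.ofReal
        (1 / 20000 * (1 / ε ^ 2 * ((d : ℝ) + (n : ℝ) * Real.log (((min n d : ℕ) : ℝ) / δ))))
          ≤ (Q T).expectedSamples D by
    obtain ⟨T, D, h1, h2, h3⟩ := h
    refine ⟨T, D, h1, h2, h3, fun hnd => ?_⟩
    rwa [min_eq_left hnd] at h3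
  set k := min n d with hkdef
  have hk : 0 < k := lt_min hn hd
  have hk1 : (1 : ℝ) ≤ k := by exact_mod_cast hk
  have hn1 : (1 : ℝ) ≤ n := by exact_mod_cast hn
  have hlog : 2 ≤ Real.log (k / δ) := by
    have h8 : Real.log 8 = 3 * Real.log 2 := by
      rw [show (8 : ℝ) = 2 ^ 3 by norm_num, Real.log_pow]
      norm_num
    have h : Real.log 8 ≤ Real.log (k / δ) := by
      refine Real.log_le_log (by norm_num) ?_
      rw [le_div_iff₀ hδ]
      linarith
    linarith [Real.log_two_gt_d9]
  have hε2 : 0 < ε ^ 2 := by positivity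
  -- The dominant term is at least half of the sum. In the second case `d ≥ n log (k/δ) ≥ 2`, as
  -- identification requires.
  rcases le_total (d : ℝ) (n * Real.log (k / δ)) with hle | hle
  · have hm : 0 < n / k := Nat.div_pos (min_le_left _ _) hk
    -- Rounding down to equal groups discards at most half of the oracles.
    have hnkm : (n : ℝ) ≤ 2 * (k * (n / k : ℕ)) := by
      have h1 := Nat.div_add_mod n k
      have h2 := Nat.mod_lt n hk
      have h3 : k * 1 ≤ k * (n / k) := Nat.mul_le_mul_left k hm
      exact_mod_cast (show n ≤ 2 * (k * (n / k)) by omega)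
    obtain ⟨D, hD⟩ := CollabLearning.exists_le_expectedSamples_groupTask (d := d) hn hk
      (min_le_right n d) (Nat.mul_div_le n k) (Q _) hm hε hε8 hδ hδ8 fun D => hQ _ D
    refine ⟨_, D, rfl, CollabLearning.coinTask_H_card, le_trans (ENNReal.ofReal_le_ofReal ?_) hD⟩
    have h1 := mul_le_mul_of_nonneg_right hnkm (show 0 ≤ Real.log (k / δ) by linarith)
    rw [le_div_iff₀ (by positivity)]
    have : 1 / 20000 * (1 / ε ^ 2 * (d + n * Real.log (k / δ))) * (4608 * ε ^ 2) =
        4608 / 20000 * (d + n * Real.log (k / δ)) := by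
      field_simp
    rw [this]
    nlinarith
  · have hd2 : 2 ≤ d := by
      have : (2 : ℝ) ≤ d := by nlinarith
      exact_mod_cast this
    obtain ⟨D, hD⟩ := CollabLearning.exists_le_expectedSamples_identTask hn hd2 hε hε8 hδ8 (Q _)
      fun D => hQ (CollabLearning.identTask d hn) D
    refine ⟨_, D, rfl, CollabLearning.coinTask_H_card, le_trans (ENNReal.ofReal_le_ofReal ?_) hD⟩
    rw [le_div_iff₀ (by positivity)]
    have : 1 / 20000 * (1 / ε ^ 2 * (d + n * Real.log (k / δ))) * (128 * ε ^ 2) =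
        128 / 20000 * (d + n * Real.log (k / δ)) := by
      field_simp
    rw [this]
    nlinarith [Real.log_two_gt_d9]
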